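/- All graphs are finite and simple, and distances are taken in the graph $G$ under consideration (vertices in different connected components are at infinite distance). $\mathrm{MDS}(G)$ denotes the minimum size of a dominating set of $G$, $N[v]$ the closed neighbourhood of $v$, and $N^r[S]$ the set of vertices at distance at most $r$ from some vertex of $S$. For $S\subseteq V(G)$ and an integer $r>0$, an $r$-component of $S$ is a maximal subset $S'\subseteq S$ such that any two vertices of $S'$ are joined by a sequence of vertices of $S'$ in which consecutive vertices are at distance at most $r$ in $G$. A graph class $\mathcal C$ has asymptotic dimension at most $d$ with control function $f:\mathbb N\to\mathbb N$ if for every $G\in\mathcal C$ and every integer $r>0$ there is a cover $V(G)=\bigcup_{i=0}^{d}B_i$ such that any two vertices in the same $r$-component of some $B_i$ are at distance at most $f(r)$ in $G$. A $k$-cut of a graph $H$ is an inclusion-minimal set of vertices whose removal increases the number of connected components of $H$ and which has size $k$. An $r$-local $k$-cut of $G$ is a set $c\subseteq V(G)$ whose vertices are pairwise at distance at most $r$ in $G$ and which is a $k$-cut of $G[N^r[c]]$. A vertex $v$ of $G$ is $r$-interesting if there is an $r$-local $2$-cut $c=\{u,v\}$ of $G$ such that $N[v]\not\subseteq N[u]$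 and at least two connected components of $G[N^r[c]]-c$ each contain a vertex non-adjacent to $u$. **Lemma.** Let $d\ge 0$ be an integer, let $\mathcal C$ be a graph class of asymptotic dimension at most $d$ with control function $f$, and let $m=f(11)+4$ or $m=f(11)+5$. Then every $G\in\mathcal C$ has at most $22(d+1)\cdot\mathrm{MDS}(G)$ $m$-interesting vertices. -/

import Mathlib

universe u

namespace DomCuts

/-- The ball neighbourhood `N^r[S]`: all vertices at distance at most `r` from some vertex of `S`.
Vertices in different connected components are at distance `⊤`. -/
def nbhd {V : Type u} (G : SimpleGraph V) (r : ℕ) (S : Set V) : Set V :=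
  {w | ∃ v ∈ S, G.edist v w ≤ (r : ℕ∞)}

/-- The closed neighbourhood `N[v]` of a vertex. -/
def closedNbhd {V : Type u} (G : SimpleGraph V) (v : V) : Set V :=
  insert v (G.neighborSet v)

/-! ### Domination number -/

/-- Every vertex is in `D` or adjacent to a vertex of `D`. -/
def IsDominating {V : Type u} (G : SimpleGraph V) (D : Set V) : Prop :=
  ∀ v, v ∈ D ∨ ∃ d ∈ D, G.Adj d v

/-- The minimum size of a dominating set (used for finite graphs only). -/
noncomputable def MDS {V : Type u} (G : SimpleGraph V) : ℕ :=
  sInf {n | ∃ D : Set V, IsDominating G D ∧ D.ncard = n}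

/-! ### Asymptotic dimension -/

/-- A class of graphs. -/
abbrev GraphClass : Type (u + 1) := ∀ V : Type u, SimpleGraph V → Prop

/-- `S` has weak diameter at most `D` in `G`. -/
def IsBoundedBy {V : Type u} (G : SimpleGraph V) (D : ℕ) (S : Set V) : Prop :=
  ∀ u ∈ S, ∀ v ∈ S, G.edist u v ≤ (D : ℕ∞)

/-- Any two vertices of `T` are joined by a sequence of vertices of `T` in which consecutive
vertices are at distance at most `r` in `G`. -/
def IsRConnected {V : Type u} (G : SimpleGraph V) (r : ℕ) (T : Set V) : Prop :=
  ∀ u ∈ T, ∀ v ∈ T,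
    Relation.ReflTransGen (fun a b => a ∈ T ∧ b ∈ T ∧ G.edist a b ≤ (r : ℕ∞)) u v

/-- `T` is an `r`-component of `S`. -/
def IsRComponent {V : Type u} (G : SimpleGraph V) (r : ℕ) (S T : Set V) : Prop :=
  Maximal (fun T' : Set V => T' ⊆ S ∧ IsRConnected G r T') T

/-- `f` witnesses that the class `C` (of finite graphs) has asymptotic dimension at most `d`:
for every `r > 0`, every graph of the class is covered by `d + 1` sets all of whose
`r`-components have weak diameter at most `f r`. -/
def IsControlFunction (C : GraphClass.{u}) (d : ℕ) (f : ℕ → ℕ) : Prop :=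
  ∀ (V : Type u) [Finite V] (G : SimpleGraph V), C V G → ∀ r : ℕ, 0 < r →
    ∃ B : Fin (d + 1) → Set V, (⋃ i, B i) = Set.univ ∧
      ∀ i, ∀ T : Set V, IsRComponent G r (B i) T → IsBoundedBy G (f r) T

/-! ### Cuts, local cuts and interesting vertices -/

/-- The graph `G - c`. -/
abbrev deleteVerts {V : Type u} (G : SimpleGraph V) (c : Set V) :
    SimpleGraph (cᶜ : Set V) :=
  G.induce cᶜ

/-- Removing `c` increases the number of connected components. -/
def Separates {V : Type u} (G : SimpleGraph V) (c : Set V) : Prop :=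
  Nat.card G.ConnectedComponent < Nat.card (deleteVerts G c).ConnectedComponent

/-- A `k`-cut: an inclusion-minimal set of vertices whose removal increases the number of
connected components, of size `k`. -/
def IsKCut {V : Type u} (G : SimpleGraph V) (k : ℕ) (c : Set V) : Prop :=
  c.ncard = k ∧ Minimal (Separates G) c

/-- The graph `G[N^r[c]]`. -/
abbrev localGraph {V : Type u} (G : SimpleGraph V) (r : ℕ) (c : Set V) :
    SimpleGraph (nbhd G r c) :=
  G.induce (nbhd G r c)

/-- The set `c`, seen as a set of vertices of `G[N^r[c]]`. -/
abbrev localSet {V : Type u} (G : SimpleGraph V) (r : ℕ) (c : Set V) : Set (nbhd G r c) :=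
  {x | x.1 ∈ c}

/-- An `r`-local `k`-cut. -/
def IsLocalKCut {V : Type u} (G : SimpleGraph V) (r k : ℕ) (c : Set V) : Prop :=
  (∀ u ∈ c, ∀ v ∈ c, G.edist u v ≤ (r : ℕ∞)) ∧
    IsKCut (localGraph G r c) k (localSet G r c)

/-- The vertex `v` is `r`-interesting: it lies in some `r`-local `2`-cut `c = {u, v}` such that
`N[v] ⊈ N[u]` and at least two connected components of `G[N^r[c]] - c` each contain a vertex
non-adjacent to `u`. -/
def IsInteresting {V : Type u} (G : SimpleGraph V) (r : ℕ) (v : V) : Prop :=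
  ∃ u : V, IsLocalKCut G r 2 {u, v} ∧
    ¬ closedNbhd G v ⊆ closedNbhd G u ∧
    ∃ K₁ K₂ :
        (deleteVerts (localGraph G r {u, v}) (localSet G r {u, v})).ConnectedComponent,
      K₁ ≠ K₂ ∧ (∃ w ∈ K₁.supp, ¬ G.Adj u w.1.1) ∧ (∃ w ∈ K₂.supp, ¬ G.Adj u w.1.1)

end DomCuts

/-! Fix a minimum dominating set `D`, a dominator `dm x ∈ D` of every vertex `x`, and a cut partner
`U v` of every interesting `v`. Around `v`, the cut `{U v, v}` has two sides, each with a vertex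
that `U v` does not dominate. This gives `v` an edge of a multigraph on `D`, joining dominators on
opposite sides; the edge stands for a walk of `G`. On a cycle through the edge of `v`, the walks of
the other edges would reconnect the two sides, so one of them meets `v` or `U v`. Meetings with `v`
are harmless after rerouting and after splitting the vertices into two classes
(`card_le_of_partner`). Meetings with `U v` mean that every cycle through the edge has an edge at
one fixed hub, and a multigraph with this property has at most `3 * |D|` edges
(`HubGraph.Hubbed.card_le`).

This is applied to three kinds of `v ∉ D`: `dm v ≠ U v` and the cut separates `dm v` from a
neighbour of `v` not dominated by `U v`; `dm v ≠ U v` without such a neighbour; `dm v = U v`. In the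
last two `U v ∈ D`. Each kind costs `2 * 3 * |D|`, and `D` itself adds `|D|`, which yields the
factor 19.

Since the cuts are only local, vertices are grouped by the component `T` of a cover set that
contains `v` or `U v`. All walks used stay in `N^4[T]`, which lies within `f 11 + 4` of the cut, and
distinct components of a cover set have disjoint 4-neighbourhoods because `8 ≤ 11`. So each of the
`d + 1` cover sets counts `D` at most once. -/

namespace DomCuts

/-! ### Counting the edges of a multigraph with obstructed cycles -/

/-- A multigraph whose edges carry a hub vertex, a leaf of that hub, and an attachment point at each
of their ends. -/
structure HubGraph (ι V : Type*) where
  src : ι → V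
  tgt : ι → V
  hub : ι → V
  leaf : ι → V
  att : ι → V → V

namespace HubGraph

variable {ι V : Type*} (M : HubGraph ι V)

/-- `x` is an end of `e`. -/
def Inc (e : ι) (x : V) : Prop := M.src e = x ∨ M.tgt e = x

/-- `x` and `y` are the ends of `e`. -/
def Joins (e : ι) (x y : V) : Prop :=
  (M.src e = x ∧ M.tgt e = y) ∨ (M.src e = y ∧ M.tgt e = x)

/-- `e'` obstructs `e`: it passes through the hub of `e`, and through the leaf of `e` if the hub is
an end of `e`. -/
def Obstructs (e' e : ι) : Prop :=
  M.Inc e' (M.hub e) ∧ (M.Inc e (M.hub e) → M.att e' (M.hub e) = M.leaf e)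

/-- `x` and `y` are the ends of an edge of `E` other than `e` that does not obstruct `e`. -/
def Step (E : Finset ι) (e : ι) (x y : V) : Prop :=
  ∃ e' ∈ E, e' ≠ e ∧ ¬ M.Obstructs e' e ∧ M.Joins e' x y

/-- Every cycle through an edge of `E` contains an edge obstructing it. -/
structure Hubbed (E : Finset ι) : Prop where
  ne : ∀ e ∈ E, M.src e ≠ M.tgt e
  att_ne : ∀ e ∈ E, M.Inc e (M.hub e) → M.att e (M.hub e) ≠ M.leaf e
  sep : ∀ e ∈ E, ¬ Relation.ReflTransGen (M.Step E e) (M.src e) (M.tgt e)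

/-- All edges of `E` at `x` have the same attachment point. -/
def Mono (E : Finset ι) (x : V) : Prop :=
  ∀ e ∈ E, ∀ e' ∈ E, M.Inc e x → M.Inc e' x → M.att e x = M.att e' x

/-- The vertices `x 0, …, x k` and the edges `f 0, …, f (k - 1)` form a path all of whose inner
vertices are monochromatic or passed between different attachment points. -/
structure IsPath (E : Finset ι) (k : ℕ) (x : ℕ → V) (f : ℕ → ι) : Prop where
  inj : ∀ i ≤ k, ∀ j ≤ k, x i = x j → i = j
  mem : ∀ i < k, f i ∈ E
  joins : ∀ i < k, M.Joins (f i) (x i) (x (i + 1))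
  pass : ∀ i, i + 1 < k → M.Mono E (x (i + 1)) ∨
    M.att (f i) (x (i + 1)) ≠ M.att (f (i + 1)) (x (i + 1))

variable {M}

theorem Joins.symm {e : ι} {x y : V} (h : M.Joins e x y) : M.Joins e y x := h.elim Or.inr Or.inl

theorem Joins.inc_left {e : ι} {x y : V} (h : M.Joins e x y) : M.Inc e x :=
  h.elim (fun h => Or.inl h.1) (fun h => Or.inr h.2)

theorem Joins.inc_right {e : ι} {x y : V} (h : M.Joins e x y) : M.Inc e y := h.symm.inc_left

theorem Joins.inc_iff {e : ι} {x y z : V} (h : M.Joins e x y) : M.Inc e z ↔ z = x ∨ z = y := by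
  unfold Inc
  rcases h with ⟨rfl, rfl⟩ | ⟨rfl, rfl⟩
  · exact or_congr eq_comm eq_comm
  · rw [or_comm]; exact or_congr eq_comm eq_comm

theorem Inc.exists_joins {e : ι} {x : V} (h : M.Inc e x) : ∃ y, M.Joins e x y := by
  rcases h with h | h
  · exact ⟨_, Or.inl ⟨h, rfl⟩⟩
  · exact ⟨_, Or.inr ⟨rfl, h⟩⟩

theorem Step.symm {E : Finset ι} {e : ι} {x y : V} (h : M.Step E e x y) : M.Step E e y x := by
  obtain ⟨e', h1, h2, h3, h4⟩ := h
  exact ⟨e', h1, h2, h3, h4.symm⟩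

theorem Hubbed.mono {E E' : Finset ι} (h : M.Hubbed E) (hE : E' ⊆ E) : M.Hubbed E' where
  ne e he := h.ne e (hE he)
  att_ne e he := h.att_ne e (hE he)
  sep e he hr := h.sep e (hE he)
    (Relation.ReflTransGen.mono (fun _ _ ⟨e', h1, h2⟩ => ⟨e', hE h1, h2⟩) _ _ hr)

theorem Mono.mono {E E' : Finset ι} {x : V} (h : M.Mono E x) (hE : E' ⊆ E) : M.Mono E' x :=
  fun e he e' he' => h e (hE he) e' (hE he')

theorem Hubbed.not_reach {E : Finset ι} (h : M.Hubbed E) {e : ι} (he : e ∈ E) {x y : V}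
    (hj : M.Joins e x y) : ¬ Relation.ReflTransGen (M.Step E e) x y := by
  rcases hj with ⟨rfl, rfl⟩ | ⟨rfl, rfl⟩
  · exact h.sep e he
  · intro hr
    refine h.sep e he ?_
    have : Std.Symm (M.Step E e) := ⟨fun _ _ => Step.symm⟩
    exact symm hr

theorem IsPath.reach {E : Finset ι} {k : ℕ} {x : ℕ → V} {f : ℕ → ι} (hP : M.IsPath E k x f)
    (e : ι) {i j : ℕ} (hij : i ≤ j) (hj : j ≤ k)
    (hgood : ∀ t, i ≤ t → t < j → f t ≠ e ∧ ¬ M.Obstructs (f t) e) :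
    Relation.ReflTransGen (M.Step E e) (x i) (x j) := by
  induction j, hij using Nat.le_induction with
  | base => exact .refl
  | succ n hn ih =>
    refine (ih (by omega) fun t h1 h2 => hgood t h1 (by omega)).tail ?_
    obtain ⟨h1, h2⟩ := hgood n hn (by omega)
    exact ⟨f n, hP.mem n (by omega), h1, h2, hP.joins n (by omega)⟩

/-- The obstruction on the cycle closed by an edge from the end of a path back to the path. -/
theorem IsPath.exists_obstructs {E : Finset ι} (h : M.Hubbed E) {k : ℕ} {x : ℕ → V} {f : ℕ → ι}
    (hP : M.IsPath E (k + 1) x f) {g : ι} (hg : g ∈ E) (hgf : g ≠ f k) {i : ℕ} (hi : i ≤ k)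
    (hj : M.Joins g (x (k + 1)) (x i)) : ∃ t, i ≤ t ∧ t ≤ k ∧ M.Obstructs (f t) g := by
  by_contra! hcon
  refine h.not_reach hg hj.symm (hP.reach g (by omega) le_rfl fun t h1 h2 => ⟨?_, ?_⟩)
  · rintro rfl
    have h3 := hP.joins t h2
    have h4 := (h3.inc_iff.1 hj.inc_left)
    have h5 : t = k := by
      rcases h4 with h4 | h4
      · have := hP.inj _ le_rfl _ h2.le h4; omega
      · have := hP.inj _ le_rfl _ (by omega) h4; omega
    exact hgf (by rw [h5])
  · exact hcon t h1 (by omega)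

/-- The obstruction on the cycle closed by two edges from the end of a path back to the path. -/
theorem IsPath.exists_obstructs_pair {E : Finset ι} (h : M.Hubbed E) {k : ℕ} {x : ℕ → V}
    {f : ℕ → ι} (hP : M.IsPath E (k + 1) x f) {g g' : ι} (hg : g ∈ E) (hg' : g' ∈ E)
    (hgg : g' ≠ g) {i j : ℕ} (hi : i ≤ k) (hji : j ≤ i)
    (hj : M.Joins g (x (k + 1)) (x i)) (hj' : M.Joins g' (x (k + 1)) (x j)) :
    M.Obstructs g' g ∨ ∃ t, j ≤ t ∧ t < i ∧ M.Obstructs (f t) g := by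
  by_contra! hcon
  refine h.not_reach hg hj (.head ⟨g', hg', hgg, hcon.1, hj'⟩
    (hP.reach g hji (by omega) fun t h1 h2 => ⟨?_, hcon.2 t h1 h2⟩))
  rintro rfl
  rcases (hP.joins t (by omega)).inc_iff.1 hj.inc_left with h4 | h4
  · have := hP.inj _ le_rfl _ (by omega) h4; omega
  · have := hP.inj _ le_rfl _ (by omega) h4; omega

theorem IsPath.inc_vertex {E : Finset ι} {k : ℕ} {x : ℕ → V} {f : ℕ → ι} (hP : M.IsPath E k x f)
    {t s : ℕ} (ht : t < k) (hs : s ≤ k) (hinc : M.Inc (f t) (x s)) : s = t ∨ s = t + 1 := by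
  rcases (hP.joins t ht).inc_iff.1 hinc with h | h
  · exact Or.inl (hP.inj _ hs _ ht.le h)
  · exact Or.inr (hP.inj _ hs _ (by omega) h)

/-- The edges `g` and `g'` and the path form two cycles through `g` whose only common vertices are
the ends of `g`. Each contains an obstruction, so the hub of `g` is on both and is an end of `g`. At
`x (k + 1)` both `f k` and `g'` would attach at the leaf, against the passing condition. At `x i`
the passing condition forces the second obstruction to be `g'`, whence `j = i`. -/
theorem IsPath.hub_eq {E : Finset ι} (h : M.Hubbed E) {k : ℕ} {x : ℕ → V} {f : ℕ → ι}
    (hP : M.IsPath E (k + 1) x f) {g g' : ι} (hg : g ∈ E) (hg' : g' ∈ E) (hgg : g' ≠ g)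
    (hgf : g ≠ f k)
    (hpass' : M.Mono E (x (k + 1)) ∨ M.att g' (x (k + 1)) ≠ M.att (f k) (x (k + 1)))
    {i j : ℕ} (hi : i ≤ k) (hji : j ≤ i)
    (hj : M.Joins g (x (k + 1)) (x i)) (hj' : M.Joins g' (x (k + 1)) (x j)) :
    i = j ∧ M.hub g = x i ∧ M.att g' (x i) = M.leaf g ∧ M.att (f i) (x i) = M.leaf g := by
  obtain ⟨t, hit, htk, hob⟩ := hP.exists_obstructs h hg hgf hi hj
  have hob' := hP.exists_obstructs_pair h hg hg' hgg hi hji hj hj'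
  by_cases hend : M.hub g = x (k + 1)
  · exfalso
    have hinc : M.Inc g (M.hub g) := hend ▸ hj.inc_left
    have h1 := hob.2 hinc
    have h2 : t = k := by
      rcases hP.inc_vertex (by omega) le_rfl (hend ▸ hob.1) with h | h <;> omega
    subst h2
    have h3 : M.Obstructs g' g := by
      rcases hob' with h3 | ⟨s, h3, h4, h5⟩
      · exact h3
      · rcases hP.inc_vertex (by omega) le_rfl (hend ▸ h5.1) with h | h <;> omega
    have h4 := h3.2 hinc
    rcases hpass' with hm | hne
    · refine h.att_ne g hg hinc ?_
      rw [← h4, hend]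
      exact hm _ hg _ hg' hj.inc_left hj'.inc_left
    · exact hne (by rw [← hend, h1, h4])
  by_cases hmid : M.hub g = x i
  · have hinc : M.Inc g (M.hub g) := hmid ▸ hj.inc_right
    have h1 := hob.2 hinc
    have h2 : t = i := by
      rcases hP.inc_vertex (by omega) (by omega) (hmid ▸ hob.1) with h | h <;> omega
    subst h2
    rcases hob' with h3 | ⟨s, h3, h4, h5⟩
    · refine ⟨?_, hmid, hmid ▸ h3.2 hinc, hmid ▸ h1⟩
      rcases hj'.inc_iff.1 (hmid ▸ h3.1) with h | h
      · have := hP.inj _ (by omega) _ le_rfl h; omega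
      · exact hP.inj _ (by omega) _ (by omega) h
    · exfalso
      have h6 : s + 1 = t := by
        rcases hP.inc_vertex (by omega) (by omega) (hmid ▸ h5.1) with h | h <;> omega
      subst h6
      have h7 := h5.2 hinc
      rw [hmid] at h7 h1
      rcases hP.pass s (by omega) with hm | hne
      · refine h.att_ne g hg hinc ?_
        rw [← h1, hmid]
        exact hm _ hg _ (hP.mem _ (by omega)) hj.inc_right
          (hP.joins _ (by omega)).inc_left
      · exact hne (h7.trans h1.symm)
  exfalso
  have key : ∃ s, i < s ∧ s ≤ k ∧ M.hub g = x s := by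
    rcases (hP.joins t (by omega)).inc_iff.1 hob.1 with h1 | h1
    · exact ⟨t, lt_of_le_of_ne hit (by rintro rfl; exact hmid h1), htk, h1⟩
    · refine ⟨t + 1, by omega, ?_, h1⟩
      by_contra! h2
      have : t = k := by omega
      exact hend (this ▸ h1)
  have key' : ∃ s, s < i ∧ M.hub g = x s := by
    rcases hob' with h3 | ⟨s, h3, h4, h5⟩
    · rcases hj'.inc_iff.1 h3.1 with h1 | h1
      · exact absurd h1 hend
      · exact ⟨j, lt_of_le_of_ne hji (by rintro rfl; exact hmid h1), h1⟩
    · rcases (hP.joins s (by omega)).inc_iff.1 h5.1 with h1 | h1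
      · exact ⟨s, h4, h1⟩
      · exact ⟨s + 1, lt_of_le_of_ne (by omega) (by rintro rfl; exact hmid h1), h1⟩
  obtain ⟨s, h1, h2, h3⟩ := key
  obtain ⟨s', h1', h3'⟩ := key'
  have := hP.inj s (by omega) s' (by omega) (h3.symm.trans h3')
  omega

/-- At the end of a path, at most one further edge continues it back into the path. -/
theorem IsPath.unique_back {E : Finset ι} (h : M.Hubbed E) {k : ℕ} {x : ℕ → V} {f : ℕ → ι}
    (hP : M.IsPath E (k + 1) x f) {g g' : ι} (hg : g ∈ E) (hg' : g' ∈ E)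
    (hgf : g ≠ f k) (hgf' : g' ≠ f k)
    (hpass : M.Mono E (x (k + 1)) ∨ M.att g (x (k + 1)) ≠ M.att (f k) (x (k + 1)))
    (hpass' : M.Mono E (x (k + 1)) ∨ M.att g' (x (k + 1)) ≠ M.att (f k) (x (k + 1)))
    {i j : ℕ} (hi : i ≤ k) (hjk : j ≤ k)
    (hj : M.Joins g (x (k + 1)) (x i)) (hj' : M.Joins g' (x (k + 1)) (x j)) : g' = g := by
  by_contra hgg
  wlog hji : j ≤ i generalizing g g' i j
  · exact this hg' hg hgf' hgf hpass' hpass hjk hi hj' hj (fun h => hgg h.symm) (by omega)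
  obtain ⟨rfl, h1, h2, h3⟩ := hP.hub_eq h hg hg' hgg hgf hpass' hi hji hj hj'
  obtain ⟨-, h4, h5, h6⟩ := hP.hub_eq h hg' hg (fun h => hgg h.symm) hgf' hpass hi le_rfl hj' hj
  -- By symmetry `g` attaches at `x i` to the leaf of `g'`, which is the attachment of `f i`, which
  -- is the leaf of `g`.
  refine h.att_ne g hg (h1 ▸ hj.inc_right) ?_
  rw [h1, h5, ← h6, h3]

theorem IsPath.extend {E : Finset ι} {k : ℕ} {x : ℕ → V} {f : ℕ → ι}
    (hP : M.IsPath E (k + 1) x f) {g : ι} (hg : g ∈ E)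
    (hpass : M.Mono E (x (k + 1)) ∨ M.att g (x (k + 1)) ≠ M.att (f k) (x (k + 1))) {y : V}
    (hj : M.Joins g (x (k + 1)) y) (hy : ∀ i ≤ k + 1, x i ≠ y) :
    M.IsPath E (k + 2) (Function.update x (k + 2) y) (Function.update f (k + 1) g) := by
  have hx : ∀ i ≤ k + 1, Function.update x (k + 2) y i = x i := fun i hi =>
    Function.update_of_ne (by omega) _ _
  have hf : ∀ i ≤ k, Function.update f (k + 1) g i = f i := fun i hi =>
    Function.update_of_ne (by omega) _ _
  refine ⟨fun i hi j hj => ?_, fun i hi => ?_, fun i hi => ?_, fun i hi => ?_⟩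
  · rcases Nat.lt_or_ge (k + 1) i with h1 | h1 <;> rcases Nat.lt_or_ge (k + 1) j with h2 | h2
    · intro; omega
    · obtain rfl : i = k + 2 := by omega
      rw [hx j h2, Function.update_self]
      exact fun h => absurd h.symm (hy j h2)
    · obtain rfl : j = k + 2 := by omega
      rw [hx i h1, Function.update_self]
      exact fun h => absurd h (hy i h1)
    · rw [hx i h1, hx j h2]; exact hP.inj i h1 j h2
  · rcases Nat.lt_or_ge k i with h1 | h1
    · obtain rfl : i = k + 1 := by omega
      simpa using hg
    · rw [hf i h1]; exact hP.mem i (by omega)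
  · rcases Nat.lt_or_ge k i with h1 | h1
    · obtain rfl : i = k + 1 := by omega
      rw [hx _ le_rfl, Function.update_self, Function.update_self]; exact hj
    · rw [hf i h1, hx i (by omega), hx _ (by omega)]; exact hP.joins i (by omega)
  · rw [hx _ (by omega), hf i (by omega)]
    rcases Nat.lt_or_ge i k with h1 | h1
    · rw [hf _ (by omega)]; exact hP.pass i (by omega)
    · obtain rfl : i = k := by omega
      rw [Function.update_self]; exact hpass.imp_right Ne.symm

/-- Here `x` is the end of a longest path and `f` its last edge. An edge allowed to continue the
path must lead back into it, and by `unique_back` there is at most one, `r`. The remaining edges are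
those forbidden to continue. -/
theorem Hubbed.exists_end {E : Finset ι} (h : M.Hubbed E) (hE : E.Nonempty) {D : Finset V}
    (hD : ∀ e ∈ E, ∀ x, M.Inc e x → x ∈ D) :
    ∃ x ∈ D, ∃ f r : ι, ∀ g ∈ E, M.Inc g x →
      g = f ∨ g = r ∨ (¬ M.Mono E x ∧ M.att g x = M.att f x) := by
  classical
  have hbound : ∀ k x f, M.IsPath E (k + 1) x f → k + 1 ≤ D.card := by
    intro k x f hP
    have : (Finset.range (k + 1)).card ≤ D.card := by
      refine Finset.card_le_card_of_injOn x (fun i hi => ?_) (fun i hi j hj hij => ?_)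
      · simp only [Finset.coe_range, Set.mem_Iio] at hi
        exact hD _ (hP.mem i hi) _ (hP.joins i hi).inc_left
      · simp only [Finset.coe_range, Set.mem_Iio] at hi hj
        exact hP.inj i hi.le j hj.le hij
    simpa using this
  obtain ⟨e, he⟩ := hE
  have hstart : ∃ k x f, k ≤ D.card ∧ M.IsPath E (k + 1) x f := by
    refine ⟨0, fun i => if i = 0 then M.src e else M.tgt e, fun _ => e, Nat.zero_le _,
      fun i hi j hj hij => ?_, fun _ _ => he, fun i hi => ?_, fun i hi => by omega⟩
    · have := h.ne e he
      by_cases hi0 : i = 0 <;> by_cases hj0 : j = 0 <;> simp [hi0, hj0] at hij <;>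
        first | omega | exact absurd hij this | exact absurd hij.symm this
    · obtain rfl : i = 0 := by omega
      exact Or.inl ⟨rfl, rfl⟩
  let P : ℕ → Prop := fun k => ∃ x f, M.IsPath E (k + 1) x f
  obtain ⟨k₀, x₀, f₀, hk₀, hP₀⟩ := hstart
  have hmax := Nat.findGreatest_spec (P := P) hk₀ ⟨x₀, f₀, hP₀⟩
  set k := Nat.findGreatest P D.card with hk
  obtain ⟨x, f, hP⟩ := hmax
  have hback : ∀ g ∈ E, M.Inc g (x (k + 1)) →
      (M.Mono E (x (k + 1)) ∨ M.att g (x (k + 1)) ≠ M.att (f k) (x (k + 1))) →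
      ∃ i ≤ k, M.Joins g (x (k + 1)) (x i) := by
    intro g hg hinc hpass
    obtain ⟨y, hy⟩ := hinc.exists_joins
    by_cases hex : ∃ i ≤ k + 1, x i = y
    · obtain ⟨i, hi, rfl⟩ := hex
      refine ⟨i, ?_, hy⟩
      by_contra! hlt
      obtain rfl : i = k + 1 := by omega
      rcases hy with ⟨h1, h2⟩ | ⟨h1, h2⟩ <;> exact h.ne g hg (h1.trans h2.symm)
    · push Not at hex
      have hP' := hP.extend hg hpass hy hex
      have := Nat.le_findGreatest (P := P) (n := D.card) (m := k + 1)
        (by have := hbound _ _ _ hP'; omega) ⟨_, _, hP'⟩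
      omega
  refine ⟨x (k + 1), hD _ (hP.mem k (by omega)) _ (hP.joins k (by omega)).inc_right, f k, ?_⟩
  by_cases hr : ∃ r ∈ E, M.Inc r (x (k + 1)) ∧ r ≠ f k ∧
      (M.Mono E (x (k + 1)) ∨ M.att r (x (k + 1)) ≠ M.att (f k) (x (k + 1)))
  · obtain ⟨r, hrE, hrinc, hrf, hrpass⟩ := hr
    refine ⟨r, fun g hg hinc => ?_⟩
    by_cases hgf : g = f k
    · exact Or.inl hgf
    by_cases hgpass : M.Mono E (x (k + 1)) ∨ M.att g (x (k + 1)) ≠ M.att (f k) (x (k + 1))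
    · obtain ⟨i, hi, hji⟩ := hback g hg hinc hgpass
      obtain ⟨j, hj, hjj⟩ := hback r hrE hrinc hrpass
      exact Or.inr (Or.inl (hP.unique_back h hrE hg hrf hgf hrpass hgpass hj hi hjj hji))
    · push Not at hgpass
      exact Or.inr (Or.inr hgpass)
  · push Not at hr
    refine ⟨f k, fun g hg hinc => ?_⟩
    by_cases hgf : g = f k
    · exact Or.inl hgf
    · exact Or.inr (Or.inr (hr g hg hinc hgf))

-- Induction on `|E| + |D|` at the vertex `x` of `exists_end`. If `x` is monochromatic, it has at
-- most two edges, and deleting it pays for them. Otherwise deleting `r` makes `x` monochromatic, so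
-- one edge is paid for by the last term.
open Classical in
theorem Hubbed.card_le_add {E : Finset ι} (h : M.Hubbed E) {D : Finset V}
    (hD : ∀ e ∈ E, ∀ x, M.Inc e x → x ∈ D) :
    E.card ≤ 2 * D.card + (D.filter fun x => ¬ M.Mono E x).card := by
  induction hn : E.card + D.card using Nat.strong_induction_on generalizing E D with
  | _ n ih =>
  subst hn
  rcases E.eq_empty_or_nonempty with rfl | hE
  · simp
  obtain ⟨x, hxD, f, r, hfr⟩ := h.exists_end hE hD
  have hfilter : ∀ E' ⊆ E, ∀ D' ⊆ D,
      (D'.filter fun x => ¬ M.Mono E' x) ⊆ D.filter fun x => ¬ M.Mono E x := by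
    intro E' hE' D' hD' y hy
    rw [Finset.mem_filter] at hy ⊢
    exact ⟨hD' hy.1, fun hm => hy.2 (hm.mono hE')⟩
  by_cases hm : M.Mono E x
  · let E' := E.filter fun e => ¬ M.Inc e x
    have hE' : E' ⊆ E := Finset.filter_subset _ _
    have hcard : E.card ≤ E'.card + 2 := by
      have h1 : E ⊆ E' ∪ {f, r} := by
        intro g hg
        simp only [Finset.mem_union, E', Finset.mem_filter, Finset.mem_insert,
          Finset.mem_singleton]
        by_cases hinc : M.Inc g x
        · rcases hfr g hg hinc with h | h | h
          · exact Or.inr (Or.inl h)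
          · exact Or.inr (Or.inr h)
          · exact absurd hm h.1
        · exact Or.inl ⟨hg, hinc⟩
      exact (Finset.card_le_card h1).trans ((Finset.card_union_le _ _).trans
        (Nat.add_le_add_left Finset.card_le_two _))
    have h1 := Finset.card_le_card hE'
    have h4 := Finset.card_erase_add_one hxD
    have h2 := ih _ (by omega) (h.mono hE') (D := D.erase x) (fun e he y hy => by
      refine Finset.mem_erase.2 ⟨?_, hD e (hE' he) y hy⟩
      rintro rfl
      exact (Finset.mem_filter.1 he).2 hy) rfl
    have h3 := Finset.card_le_card (hfilter E' hE' _ (Finset.erase_subset x D))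
    omega
  · have hlt : (E.erase r).card < E.card ∨ r ∉ E := by
      by_cases hr : r ∈ E
      · exact Or.inl (Finset.card_erase_lt_of_mem hr)
      · exact Or.inr hr
    have hmono : M.Mono (E.erase r) x := by
      have : ∀ e ∈ E.erase r, M.Inc e x → M.att e x = M.att f x := by
        intro e he hinc
        obtain ⟨h1, h2⟩ := Finset.mem_erase.1 he
        rcases hfr e h2 hinc with rfl | h | h
        · rfl
        · exact absurd h h1
        · exact h.2
      intro e he e' he' hinc hinc'
      rw [this e he hinc, this e' he' hinc']
    rcases hlt with hlt | hr
    · have h2 := ih _ (by omega) (h.mono (Finset.erase_subset r E)) (D := D)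
        (fun e he => hD e (Finset.mem_of_mem_erase he)) rfl
      have h3 : (D.filter fun y => ¬ M.Mono (E.erase r) y).card <
          (D.filter fun y => ¬ M.Mono E y).card := by
        refine Finset.card_lt_card ⟨hfilter _ (Finset.erase_subset r E) D subset_rfl, fun hs => ?_⟩
        exact (Finset.mem_filter.1 (hs (Finset.mem_filter.2 ⟨hxD, hm⟩))).2 hmono
      have h4 : E.card ≤ (E.erase r).card + 1 := by
        by_cases hr : r ∈ E
        · exact (Finset.card_erase_add_one hr).ge
        · rw [Finset.erase_eq_of_notMem hr]; omega
      omega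
    · rw [Finset.erase_eq_of_notMem hr] at hmono
      exact absurd hmono hm

theorem Hubbed.card_le {E : Finset ι} (h : M.Hubbed E) {D : Finset V}
    (hD : ∀ e ∈ E, ∀ x, M.Inc e x → x ∈ D) : E.card ≤ 3 * D.card := by
  classical
  have h1 := h.card_le_add hD
  have h2 := Finset.card_filter_le D fun x => ¬ M.Mono E x
  omega

end HubGraph

/-! ### Splitting vertices that block each other -/

/-- If every element of `J` has either an unblocked candidate or a partner, then `J` splits into two
classes with a choice of candidates unblocked within their class. -/
theorem card_le_of_partner {V δ : Type*} (J : Finset V) (R : V → V → Prop)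
    (hsymm : ∀ v w, R v w → R w v) (hirr : ∀ v, ¬ R v v)
    (Cand : V → δ → Prop) (Blk : V → V → δ → Prop)
    (hfree : ∀ v ∈ J, (∃ e, Cand v e ∧ ∀ w ∈ J, w ≠ v → ¬ Blk w v e) ∨ ∃ w ∈ J, R v w)
    (hpair : ∀ v ∈ J, ∀ w ∈ J, R v w →
      ∃ e, Cand v e ∧ ∀ w' ∈ J, w' ≠ v → w' ≠ w → ¬ Blk w' v e)
    (n : ℕ) (hn : ∀ I ⊆ J, ∀ F : V → δ, (∀ v ∈ I, Cand v (F v)) →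
      (∀ v ∈ I, ∀ w ∈ I, w ≠ v → ¬ Blk w v (F v)) → I.card ≤ n) :
    J.card ≤ 2 * n := by
  classical
  -- For a maximal `R`-independent `I`, an element with a partner has one in the other class: by
  -- independence for `I`, by maximality for `J \ I`.
  let P : Finset V → Prop := fun I => I ⊆ J ∧ ∀ v ∈ I, ∀ w ∈ I, ¬ R v w
  obtain ⟨I, hI⟩ : ∃ I, Maximal P I := by
    have hfin : {I | P I}.Finite :=
      (Finset.finite_toSet J.powerset).subset fun I hI => Finset.mem_powerset.2 hI.1
    exact hfin.exists_maximal ⟨∅, by simp, by simp⟩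
  have hout : ∀ v ∈ J, v ∉ I → ∃ w ∈ I, R v w := by
    intro v hv hvI
    by_contra! hcon
    refine hvI (hI.2 (y := insert v I) ⟨Finset.insert_subset hv hI.1.1, ?_⟩
      (Finset.subset_insert v I) (Finset.mem_insert_self v I))
    intro a ha b hb hab
    rcases Finset.mem_insert.1 ha with ha | ha <;> rcases Finset.mem_insert.1 hb with hb | hb
    · exact hirr _ (hb ▸ ha ▸ hab)
    · exact hcon b hb (ha ▸ hab)
    · exact hcon a ha (hsymm _ _ (hb ▸ hab))
    · exact hI.1.2 a ha b hb hab
  have hclass : ∀ C ⊆ J, (∀ v ∈ C, (∃ w ∈ J, R v w) → ∃ w ∈ J, w ∉ C ∧ R v w) → C.card ≤ n := by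
    intro C hC hpart
    have hex : ∀ v ∈ C, ∃ e, Cand v e ∧ ∀ w ∈ C, w ≠ v → ¬ Blk w v e := by
      intro v hv
      rcases hfree v (hC hv) with ⟨e, he, hblk⟩ | hw
      · exact ⟨e, he, fun w hw => hblk w (hC hw)⟩
      · obtain ⟨w, hwJ, hwC, hR⟩ := hpart v hv hw
        obtain ⟨e, he, hblk⟩ := hpair v (hC hv) w hwJ hR
        exact ⟨e, he, fun w' hw' hne => hblk w' (hC hw') hne (by rintro rfl; exact hwC hw')⟩
    rcases C.eq_empty_or_nonempty with rfl | ⟨v₀, hv₀⟩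
    · simp
    have : Nonempty δ := ⟨(hex v₀ hv₀).choose⟩
    choose! F hF hF' using hex
    exact hn C hC F hF hF'
  have h1 := hclass I hI.1.1 fun v hv ⟨w, hw, hR⟩ =>
    ⟨w, hw, fun hwI => hI.1.2 v hv w hwI hR, hR⟩
  have h2 := hclass (J \ I) Finset.sdiff_subset fun v hv _ => by
    obtain ⟨hvJ, hvI⟩ := Finset.mem_sdiff.1 hv
    obtain ⟨w, hw, hR⟩ := hout v hvJ hvI
    exact ⟨w, hI.1.1 hw, fun h => (Finset.mem_sdiff.1 h).2 hw, hR⟩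
  have h3 := Finset.card_sdiff_add_card_eq_card hI.1.1
  omega

/-! ### Walks inside a vertex set -/

variable {V : Type u} {G : SimpleGraph V}

/-- `x` and `y` are joined by a walk of `G` inside `X`. -/
def ReachIn (G : SimpleGraph V) (X : Set V) (x y : V) : Prop :=
  Relation.ReflTransGen (fun a b => G.Adj a b ∧ a ∈ X ∧ b ∈ X) x y

namespace ReachIn

variable {X Y : Set V} {x y z : V}

theorem refl (G : SimpleGraph V) (X : Set V) (x : V) : ReachIn G X x x := Relation.ReflTransGen.refl

theorem trans (h : ReachIn G X x y) (h' : ReachIn G X y z) : ReachIn G X x z :=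
  Relation.ReflTransGen.trans h h'

theorem symm (h : ReachIn G X x y) : ReachIn G X y x := by
  induction h with
  | refl => exact refl ..
  | tail _ h ih => exact Relation.ReflTransGen.head ⟨h.1.symm, h.2.2, h.2.1⟩ ih

theorem of_adj (h : G.Adj x y) (hx : x ∈ X) (hy : y ∈ X) : ReachIn G X x y :=
  Relation.ReflTransGen.single ⟨h, hx, hy⟩

theorem mono (h : ReachIn G X x y) (hXY : X ⊆ Y) : ReachIn G Y x y :=
  Relation.ReflTransGen.mono (fun _ _ h => ⟨h.1, hXY h.2.1, hXY h.2.2⟩) _ _ h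

theorem mem_right (h : ReachIn G X x y) (hx : x ∈ X) : y ∈ X := by
  induction h with
  | refl => exact hx
  | tail _ h _ => exact h.2.2

/-- A walk to another vertex reaches it through a neighbour. -/
theorem exists_adj (h : ReachIn G X x y) (hx : x ∈ X) (hxy : x ≠ y) :
    ∃ z, G.Adj z y ∧ z ∈ X ∧ ReachIn G (X \ {y}) x z := by
  induction h using Relation.ReflTransGen.head_induction_on with
  | refl => exact absurd rfl hxy
  | @head a c hac hc ih =>
    by_cases hcy : c = y
    · exact ⟨a, hcy ▸ hac.1, hx, refl ..⟩
    · obtain ⟨z, hz, hzX, hr⟩ := ih hac.2.2 hcy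
      exact ⟨z, hz, hzX, (of_adj (X := X \ {y}) hac.1 ⟨hx, hxy⟩ ⟨hac.2.2, hcy⟩).trans hr⟩

end ReachIn

theorem reachIn_ball {x y : V} (p : G.Walk x y) :
    ReachIn G {z | G.edist y z ≤ (p.length : ℕ∞)} x y := by
  induction p with
  | nil => exact ReachIn.refl ..
  | @cons a b c hab p ih =>
    have hb : G.edist c b ≤ (p.length : ℕ∞) := by
      rw [SimpleGraph.edist_comm]; exact SimpleGraph.edist_le p
    have ha : G.edist c a ≤ ((p.cons hab).length : ℕ∞) := by
      rw [SimpleGraph.edist_comm]; exact SimpleGraph.edist_le _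
    have hle : (p.length : ℕ∞) ≤ ((p.cons hab).length : ℕ∞) := by
      rw [SimpleGraph.Walk.length_cons]; exact_mod_cast Nat.le_succ _
    exact (ReachIn.of_adj hab ha (hb.trans hle)).trans (ih.mono fun z hz => le_trans hz hle)

theorem reachIn_of_edist_le {x y : V} {n : ℕ} (h : G.edist x y ≤ (n : ℕ∞)) :
    ReachIn G {z | G.edist x z ≤ (n : ℕ∞)} x y := by
  obtain ⟨p, hp⟩ := SimpleGraph.exists_walk_of_edist_ne_top
    (fun h' => by rw [SimpleGraph.edist_comm, h'] at h; exact absurd h (by simp) :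
      G.edist y x ≠ ⊤)
  refine ((reachIn_ball p).mono fun z hz => ?_).symm
  rw [SimpleGraph.edist_comm, ← hp] at h
  exact le_trans (Set.mem_ofPred.1 hz) h

theorem reachable_induce {s : Set V} {x y : V} (hx : x ∈ s) (h : ReachIn G s x y) :
    ∃ hy : y ∈ s, (G.induce s).Reachable ⟨x, hx⟩ ⟨y, hy⟩ := by
  induction h with
  | refl => exact ⟨hx, .refl _⟩
  | tail _ h ih =>
    obtain ⟨hb, hr⟩ := ih
    refine ⟨h.2.2, hr.trans (SimpleGraph.Adj.reachable ?_)⟩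
    exact h.1

/-! ### Local cuts -/

/-- The vertices of `G[N^r[{u, v}]] - {u, v}`. -/
def cutRegion (G : SimpleGraph V) (r : ℕ) (u v : V) : Set V := nbhd G r {u, v} \ {u, v}

theorem nbhd_reachIn {r : ℕ} {u v x : V} (huv : G.edist u v ≤ (r : ℕ∞))
    (hx : x ∈ nbhd G r {u, v}) : ReachIn G (nbhd G r {u, v}) u x := by
  have hball : ∀ a ∈ ({u, v} : Set V), {z | G.edist a z ≤ (r : ℕ∞)} ⊆ nbhd G r {u, v} :=
    fun a ha z hz => ⟨a, ha, hz⟩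
  obtain ⟨a, ha, hax⟩ := hx
  have h1 := (reachIn_of_edist_le hax).mono (hball a ha)
  rcases ha with rfl | rfl
  · exact h1
  · exact ((reachIn_of_edist_le huv).mono (hball u (by simp))).trans h1

theorem IsLocalKCut.ne {r : ℕ} {u v : V} (h : IsLocalKCut G r 2 {u, v}) : u ≠ v := by
  rintro rfl
  have h1 := h.2.1
  have h2 : (localSet G r {u, u}).ncard ≤ 1 := by
    refine (Set.ncard_le_one (Set.finite_of_ncard_pos (by rw [h1]; norm_num))).2 ?_
    rintro ⟨a, _⟩ ha ⟨b, _⟩ hb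
    simp only [Set.mem_ofPred_eq, Set.pair_eq_singleton, Set.mem_singleton_iff] at ha hb
    exact Subtype.ext (ha.trans hb.symm)
  omega

/-- The local graph is connected because `u` and `v` are at distance at most `r`, and by minimality
of the cut it stays connected without `u`. A walk from `x` to `v` avoiding `u` first reaches `v`
through the required neighbour. -/
theorem IsLocalKCut.reachIn [Finite V] {r : ℕ} {u v : V} (h : IsLocalKCut G r 2 {u, v}) {x : V}
    (hx : x ∈ cutRegion G r u v) : ∃ y, G.Adj v y ∧ y ≠ u ∧ ReachIn G (cutRegion G r u v) x y := by
  have hne := h.ne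
  have huv : G.edist u v ≤ (r : ℕ∞) := h.1 u (by simp) v (by simp)
  have huN : u ∈ nbhd G r {u, v} := ⟨u, by simp, by simp⟩
  have hvN : v ∈ nbhd G r {u, v} := ⟨v, by simp, by simp⟩
  have hconn : Nat.card (localGraph G r {u, v}).ConnectedComponent ≤ 1 := by
    rw [Finite.card_le_one_iff_subsingleton]
    have hpre : (localGraph G r {u, v}).Preconnected := by
      intro a b
      obtain ⟨_, ha⟩ := reachable_induce huN (nbhd_reachIn huv a.2)
      obtain ⟨_, hb⟩ := reachable_induce huN (nbhd_reachIn huv b.2)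
      exact ha.symm.trans hb
    exact hpre.subsingleton_connectedComponent
  have hns : ¬ Separates (localGraph G r {u, v}) {⟨u, huN⟩} := by
    intro hs
    have h1 := h.2.2.2 hs (by rintro _ rfl; simp)
    have h2 := h1 (show (⟨v, hvN⟩ : nbhd G r {u, v}) ∈ localSet G r {u, v} by simp)
    exact hne (congrArg Subtype.val h2).symm
  have hsub : Nat.card (deleteVerts (localGraph G r {u, v}) {⟨u, huN⟩}).ConnectedComponent ≤ 1 :=
    (not_lt.1 hns).trans hconn
  rw [Finite.card_le_one_iff_subsingleton] at hsub
  have hxu : x ≠ u := fun h => hx.2 (by simp [h])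
  have hxv : x ≠ v := fun h => hx.2 (by simp [h])
  have hreach : (deleteVerts (localGraph G r {u, v}) {⟨u, huN⟩}).Reachable
      ⟨⟨x, hx.1⟩, by simpa using hxu⟩ ⟨⟨v, hvN⟩, by simpa using hne.symm⟩ :=
    SimpleGraph.ConnectedComponent.exact (Subsingleton.elim _ _)
  rw [SimpleGraph.reachable_iff_reflTransGen] at hreach
  have hR : ReachIn G (nbhd G r {u, v} \ {u}) x v := by
    refine Relation.ReflTransGen.lift
      (r := (deleteVerts (localGraph G r {u, v}) {⟨u, huN⟩}).Adj)
      (p := fun a b => G.Adj a b ∧ a ∈ nbhd G r {u, v} \ {u} ∧ b ∈ nbhd G r {u, v} \ {u})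
      (fun a => a.1.1) (fun a b hab => ⟨hab, ?_, ?_⟩) _ _ hreach
    · exact ⟨a.1.2, fun h => a.2 (Subtype.ext h)⟩
    · exact ⟨b.1.2, fun h => b.2 (Subtype.ext h)⟩
  obtain ⟨y, hy, hyX, hr⟩ := hR.exists_adj ⟨hx.1, hxu⟩ hxv
  refine ⟨y, hy.symm, hyX.2, hr.mono fun z hz => ⟨hz.1.1, ?_⟩⟩
  rintro (h | h)
  · exact hz.1.2 h
  · exact hz.2 h

theorem deleteVerts_reachable {r : ℕ} {u v x y : V} (hx : x ∈ cutRegion G r u v)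
    (h : ReachIn G (cutRegion G r u v) x y) : ∃ hy : y ∈ cutRegion G r u v,
      (deleteVerts (localGraph G r {u, v}) (localSet G r {u, v})).Reachable
        ⟨⟨x, hx.1⟩, hx.2⟩ ⟨⟨y, hy.1⟩, hy.2⟩ := by
  induction h with
  | refl => exact ⟨hx, .refl _⟩
  | tail _ h ih =>
    obtain ⟨hb, hr⟩ := ih
    refine ⟨h.2.2, hr.trans (SimpleGraph.Adj.reachable ?_)⟩
    exact h.1

/-- The consequences of `v` being interesting by the local cut `{u, v}` that bound the number of
interesting vertices. -/
def IsCutPartner (G : SimpleGraph V) (r : ℕ) (v u : V) : Prop :=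
  u ≠ v ∧ (∃ w ∈ closedNbhd G v, w ∉ closedNbhd G u) ∧
    (∃ x₁ ∈ cutRegion G r u v, ∃ x₂ ∈ cutRegion G r u v, ¬ G.Adj u x₁ ∧ ¬ G.Adj u x₂ ∧
      ¬ ReachIn G (cutRegion G r u v) x₁ x₂) ∧
    ∀ x ∈ cutRegion G r u v, ∃ y, G.Adj v y ∧ y ≠ u ∧ ReachIn G (cutRegion G r u v) x y

theorem IsInteresting.exists_isCutPartner [Finite V] {r : ℕ} {v : V} (h : IsInteresting G r v) :
    ∃ u, IsCutPartner G r v u := by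
  obtain ⟨u, hcut, hN, K₁, K₂, hK, ⟨w₁, hw₁, ha₁⟩, ⟨w₂, hw₂, ha₂⟩⟩ := h
  refine ⟨u, hcut.ne, Set.not_subset.1 hN, ⟨w₁.1.1, ⟨w₁.1.2, w₁.2⟩, w₂.1.1, ⟨w₂.1.2, w₂.2⟩, ha₁, ha₂,
    fun hr => hK ?_⟩, fun x hx => hcut.reachIn hx⟩
  obtain ⟨_, hr'⟩ := deleteVerts_reachable (x := w₁.1.1) ⟨w₁.1.2, w₁.2⟩ hr
  rw [← hw₁, ← hw₂]
  exact SimpleGraph.ConnectedComponent.sound hr'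

/-! ### Vertices whose dominator is separated from a neighbour -/

/-- `dm` sends every vertex to a vertex of `D` dominating it. -/
structure IsDominator (G : SimpleGraph V) (D : Finset V) (dm : V → V) : Prop where
  mem : ∀ x, dm x ∈ D
  eq_self : ∀ x ∈ D, dm x = x
  adj : ∀ x, x ∉ D → G.Adj x (dm x)

theorem IsDominator.reachIn {D : Finset V} {dm : V → V} (h : IsDominator G D dm) {X : Set V} {x : V}
    (hx : x ∈ X) (hdx : dm x ∈ X) : ReachIn G X x (dm x) := by
  by_cases hxD : x ∈ D
  · rw [h.eq_self x hxD]; exact .refl ..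
  · exact .of_adj (h.adj x hxD) hx hdx

/-- Bound for the vertices `v` whose dominator is separated by `{U v, v}` from a neighbour of `v`
not dominated by `U v`. -/
theorem card_le_of_separated_nbr {J D DN : Finset V} {N : Set V} {dm U : V → V} {X : V → Set V}
    (hdm : IsDominator G D dm) (hDN : ∀ x ∈ D, x ∈ N → x ∈ DN)
    (hX : ∀ v ∈ J, ∀ z ∈ N, z ≠ U v → z ≠ v → z ∈ X v)
    (hvD : ∀ v ∈ J, v ∉ D) (hvU : ∀ v ∈ J, v ≠ U v) (hdU : ∀ v ∈ J, dm v ≠ U v)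
    (hloc : ∀ v ∈ J, v ∈ N ∧ dm v ∈ N ∧ ∀ w, G.Adj v w → w ∈ N ∧ dm w ∈ N)
    (hw : ∀ v ∈ J, ∃ w, G.Adj v w ∧ w ≠ U v ∧ dm w ≠ U v ∧ ¬ ReachIn G (X v) (dm v) w) :
    J.card ≤ 2 * (3 * DN.card) := by
  classical
  let Cand : V → V → Prop := fun v w =>
    G.Adj v w ∧ w ≠ U v ∧ dm w ≠ U v ∧ ¬ ReachIn G (X v) (dm v) w
  have hreach : ∀ v ∈ J, ∀ z ∈ N, dm z ∈ N → z ≠ U v → z ≠ v → dm z ≠ U v →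
      ReachIn G (X v) z (dm z) := by
    intro v hv z hz hdz h1 h2 h3
    refine hdm.reachIn (hX v hv z hz h1 h2) (hX v hv _ hdz h3 ?_)
    rintro h4
    exact hvD v hv (h4 ▸ hdm.mem z)
  -- A candidate `w` of `v` is blocked only by `w` itself, when `v` is in turn a candidate of `w`;
  -- two such vertices are partners.
  refine card_le_of_partner J (fun v w => Cand v w ∧ Cand w v) (fun _ _ h => ⟨h.2, h.1⟩)
    (fun v h => G.loopless.irrefl v h.1.1) Cand
    (fun v v' w' => w' = v ∧ v' ≠ U v ∧ dm v' ≠ U v ∧ ¬ ReachIn G (X v) (dm v) v') ?_ ?_ _ ?_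
  · intro v hv
    obtain ⟨w, hcand⟩ := hw v hv
    by_cases hR : w ∈ J ∧ Cand w v
    · exact Or.inr ⟨w, hR.1, hcand, hR.2⟩
    · refine Or.inl ⟨w, hcand, ?_⟩
      rintro w' hw' - ⟨rfl, h1, h2, h3⟩
      exact hR ⟨hw', hcand.1.symm, h1, h2, h3⟩
  · rintro v - w - hR
    exact ⟨w, hR.1, fun w' _ _ hne hb => hne hb.1.symm⟩
  · intro I hIJ F hF hblk
    -- Edge `v` stands for the walk `dm v, v, F v, dm (F v)`. Another such walk meeting `U v` either
    -- has an inner vertex `U v` attached to the hub `dm (U v)`, or ends at `U v ∈ D`, which is then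
    -- the hub and no end of edge `v`.
    let M : HubGraph V V :=
      { src := dm
        tgt := fun v => dm (F v)
        hub := fun v => dm (U v)
        leaf := U
        att := fun v x => if x = dm v then v else F v }
    have hnr : ∀ v ∈ I, ¬ ReachIn G (X v) (dm v) (dm (F v)) := by
      intro v hv hr
      obtain ⟨h1, h2, h3, h4⟩ := hF v hv
      have hl := (hloc v (hIJ hv)).2.2 _ h1
      exact h4 (hr.trans (hreach v (hIJ hv) _ hl.1 hl.2 h2 h1.ne' h3).symm)
    have hne : ∀ v ∈ I, dm v ≠ dm (F v) := fun v hv h =>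
      hnr v hv (by rw [← h]; exact .refl ..)
    refine HubGraph.Hubbed.card_le (M := M) (E := I) ⟨hne, ?_, ?_⟩ ?_
    · intro v hv _
      change (if _ then v else F v) ≠ U v
      split_ifs
      · exact hvU v (hIJ hv)
      · exact (hF v hv).2.1
    · intro v hv hr
      refine hnr v hv ?_
      change ReachIn G (X v) (M.src v) (M.tgt v)
      have hvJ := hIJ hv
      refine Relation.ReflTransGen.trans_induction_on
        (motive := fun {a b} _ => ReachIn G (X v) a b) hr (fun a => .refl ..) ?_
        (fun _ _ h1 h2 => h1.trans h2)
      rintro a b ⟨v', hv', hvv, hob, hj⟩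
      have hv'J := hIJ hv'
      obtain ⟨h1, h2, h3, h4⟩ := hF v' hv'
      obtain ⟨hN1, hN2, hN3⟩ := hloc v' hv'J
      obtain ⟨hN4, hN5⟩ := hN3 _ h1
      have hD : U v ∈ D → dm (U v) = U v := hdm.eq_self _
      have hend : U v ∈ D → ¬ M.Inc v (M.hub v) := by
        intro h h'
        rcases h' with h' | h'
        · exact hdU v hvJ (h'.trans (hD h))
        · exact (hF v hv).2.2.1 (h'.trans (hD h))
      have e1 : U v ≠ dm v' := by
        intro h
        have hUD : U v ∈ D := h ▸ hdm.mem v'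
        exact hob ⟨Or.inl (h.symm.trans (hD hUD).symm), fun h' => absurd h' (hend hUD)⟩
      have e2 : U v ≠ v' := by
        intro h
        refine hob ⟨Or.inl (congrArg dm h.symm), fun _ => ?_⟩
        change (if dm (U v) = dm v' then v' else F v') = U v
        rw [if_pos (congrArg dm h), h]
      have e3 : U v ≠ F v' := by
        intro h
        refine hob ⟨Or.inr (congrArg dm h.symm), fun _ => ?_⟩
        change (if dm (U v) = dm v' then v' else F v') = U v
        rw [if_neg (by rw [h]; exact (hne v' hv').symm), h]
      have e4 : U v ≠ dm (F v') := by
        intro h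
        have hUD : U v ∈ D := h ▸ hdm.mem (F v')
        exact hob ⟨Or.inr (h.symm.trans (hD hUD).symm), fun h' => absurd h' (hend hUD)⟩
      have r1 := hreach v hvJ v' hN1 hN2 e2.symm hvv e1.symm
      have key : ReachIn G (X v) (dm v') (dm (F v')) := by
        -- The walk of `v'` can meet `v` only as `F v'`. Then, as `v` does not block, `v'` is on the
        -- side of `dm v = dm (F v')`.
        by_cases hFv : F v' = v
        · have := hblk v' hv' v hv hvv.symm
          have h5 : ReachIn G (X v) (dm v) v' := by
            by_contra h5
            exact this ⟨hFv, e2.symm, e1.symm, h5⟩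
          rw [hFv]
          exact (h5.trans r1).symm
        · have r2 : ReachIn G (X v) v' (F v') :=
            .of_adj h1 (hX v hvJ _ hN1 e2.symm hvv) (hX v hvJ _ hN4 e3.symm hFv)
          exact r1.symm.trans (r2.trans (hreach v hvJ _ hN4 hN5 e3.symm hFv e4.symm))
      rcases hj with ⟨rfl, rfl⟩ | ⟨rfl, rfl⟩
      · exact key
      · exact key.symm
    · intro v hv x hx
      obtain ⟨hN1, hN2, hN3⟩ := hloc v (hIJ hv)
      rcases hx with rfl | rfl
      · exact hDN _ (hdm.mem v) hN2
      · exact hDN _ (hdm.mem (F v)) (hN3 _ (hF v hv).1).2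

/-! ### Vertices whose cut partner is dominating -/

/-- The first vertex outside `S` on a walk. -/
theorem ReachIn.exists_exit {X S : Set V} {x y : V} (h : ReachIn G X y x) (hx : x ∉ S) :
    ∃ e ∉ S, ReachIn G X y e ∧
      (e = y ∨ ∃ z, ReachIn G S y z ∧ y ∈ S ∧ z ∈ S ∧ G.Adj z e) := by
  induction h using Relation.ReflTransGen.head_induction_on with
  | refl => exact ⟨x, hx, .refl .., Or.inl rfl⟩
  | @head a c hac _ ih =>
    by_cases ha : a ∈ S
    · obtain ⟨e, he, hr, hS⟩ := ih
      have hr' : ReachIn G X a e := (ReachIn.of_adj hac.1 hac.2.1 hac.2.2).trans hr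
      refine ⟨e, he, hr', Or.inr ?_⟩
      rcases hS with rfl | ⟨z, h1, h2, h3, h4⟩
      · exact ⟨a, .refl .., ha, ha, hac.1⟩
      · exact ⟨z, (ReachIn.of_adj hac.1 ha h2).trans h1, ha, h3, h4⟩
    · exact ⟨a, ha, .refl .., Or.inl rfl⟩

/-- Bound for the vertices `v` with `U v ∈ D` that have a neighbour `A v` not dominated by `U v`
which is separated by `{U v, v}` from a further vertex not dominated by `U v`. -/
theorem card_le_of_dominating_partner {J D DN : Finset V} {N : Set V} {dm U A : V → V}
    {X : V → Set V} (hdm : IsDominator G D dm) (hDN : ∀ x ∈ D, x ∈ N → x ∈ DN)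
    (hX : ∀ v ∈ J, ∀ z ∈ N, z ≠ U v → z ≠ v → z ∈ X v)
    (hvX : ∀ v ∈ J, v ∉ X v) (hUX : ∀ v ∈ J, U v ∉ X v)
    (hvD : ∀ v ∈ J, v ∉ D) (hUD : ∀ v ∈ J, U v ∈ D)
    (hAv : ∀ v ∈ J, G.Adj v (A v)) (hAU : ∀ v ∈ J, dm (A v) ≠ U v)
    (hdv : ∀ v ∈ J, dm v = U v ∨ dm v = dm (A v))
    (hAJ : ∀ v ∈ J, ∀ v' ∈ J, U v = U v' → A v ≠ v')
    (hW : ∀ v ∈ J, ∀ x y, x ≠ v → y ≠ v → ReachIn G {z ∈ N | dm z ≠ U v} x y →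
      ReachIn G (X v) x y)
    (hvN : ∀ v ∈ J, v ∈ N) (hloc : ∀ v ∈ J, ∀ w, G.Adj v w → w ∈ N ∧ dm w ∈ N)
    (hlocU : ∀ v ∈ J, ∀ z, G.Adj z (U v) → z ∈ N ∧ ∀ w, G.Adj z w → w ∈ N ∧ dm w ∈ N)
    (hy : ∀ v ∈ J, ∃ y x, G.Adj v y ∧ y ≠ U v ∧ ¬ ReachIn G (X v) (A v) y ∧
      ReachIn G (X v) y x ∧ dm x ≠ U v) :
    J.card ≤ 2 * (3 * DN.card) := by
  classical
  have hAU' : ∀ v ∈ J, ∀ v' ∈ J, U v = U v' → A v ≠ U v' := by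
    intro v hv v' hv' h h'
    exact hAU v hv (by rw [h', hdm.eq_self _ (hUD v' hv'), h])
  have hne : ∀ v ∈ J, ∀ x ∈ D, x ≠ v := by
    rintro v hv x hx rfl
    exact hvD _ hv hx
  have hvU : ∀ v ∈ J, v ≠ U v := fun v hv h => hvD v hv (h ▸ hUD v hv)
  -- Room for the walk of an edge from `dm (A v)` to `t`. The dominators are limited so that a
  -- vertex with another partner sees nothing dominated by that partner unless it is an end of the
  -- edge; the last clause lets the walk meet only `v` and `w` among the vertices of `J` with
  -- partner `U v`.
  let Y : V → V → V → Set V := fun v t w =>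
    {z | z ∈ N ∧ z ≠ U v ∧ (dm z = U v ∨ dm z = dm (A v) ∨ dm z = t) ∧
      (z ∈ J → U z = U v → z = v ∨ z = w)}
  let Cand : V → V × V → Prop := fun v e =>
    e.1 ∈ D ∧ e.1 ∈ N ∧ e.1 ≠ U v ∧ ¬ ReachIn G (X v) (dm (A v)) e.1 ∧
      ReachIn G (Y v e.1 e.2) (dm (A v)) e.1
  -- the walk through `A v'` to its dominator, seen from `v`
  have hA : ∀ v ∈ J, ∀ v' ∈ J, U v' = U v → ReachIn G (X v) (A v') (dm (A v')) := by
    intro v hv v' hv' hU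
    obtain ⟨h1, h2⟩ := hloc v' hv' _ (hAv v' hv')
    refine hdm.reachIn (hX v hv _ h1 (hAU' v' hv' v hv hU) (hAJ v' hv' v hv hU))
      (hX v hv _ h2 ?_ (hne v hv _ (hdm.mem _)))
    rw [← hU]; exact hAU v' hv'
  -- Partners `v` and `w` share `U`, and both cuts separate `dm (A v)` from `dm (A w)`: a walk
  -- between these is a candidate for each, blocked by the other.
  refine card_le_of_partner J (fun v w => v ≠ w ∧ U v = U w ∧
    ReachIn G (Y v (dm (A w)) w) (dm (A v)) (dm (A w)) ∧
    ¬ ReachIn G (X v) (dm (A v)) (dm (A w)) ∧ ¬ ReachIn G (X w) (dm (A v)) (dm (A w))) ?_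
    (fun v h => h.1 rfl) Cand
    (fun v v' e => e.2 = v ∧ U v = U v' ∧ ¬ ReachIn G (X v) (dm (A v')) e.1) ?_ ?_ _ ?_
  · rintro v w ⟨h1, h2, h3, h4, h5⟩
    refine ⟨h1.symm, h2.symm, ?_, fun h => h5 h.symm, fun h => h4 h.symm⟩
    refine (h3.mono fun z hz => ?_).symm
    obtain ⟨k1, k2, k3, k4⟩ := hz
    exact ⟨k1, h2 ▸ k2, h2 ▸ (k3.imp_right Or.symm), fun hJ hU => (k4 hJ (hU.trans h2.symm)).symm⟩
  · intro v hv
    obtain ⟨y, x, hvy, hyU, hAy, hyx, hxU⟩ := hy v hv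
    have hyX : y ∈ X v := hX v hv y (hloc v hv y hvy).1 hyU hvy.ne'
    -- The walk from `y` is followed while it is dominated by `U v` and avoids the vertices of `J`
    -- with partner `U v`. Since `S` consists of neighbours of `U v`, the exit `e` stays near `U v`.
    let S : Set V := {s | dm s = U v ∧ s ≠ U v ∧ ¬ (s ∈ J ∧ U s = U v)}
    have hSU : ∀ s ∈ S, G.Adj s (U v) := by
      rintro s ⟨h1, h2, -⟩
      by_cases hsD : s ∈ D
      · exact absurd ((hdm.eq_self s hsD).symm.trans h1) h2
      · exact h1 ▸ hdm.adj s hsD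
    obtain ⟨e, heS, hye, hlink⟩ := hyx.exists_exit (S := S) fun h => hxU h.1
    have heX : e ∈ X v := hye.mem_right hyX
    have hev : e ≠ v := by rintro rfl; exact hvX _ hv heX
    have heU : e ≠ U v := by rintro rfl; exact hUX _ hv heX
    have heN : e ∈ N ∧ dm e ∈ N := by
      rcases hlink with rfl | ⟨z, -, -, hz, hze⟩
      · exact hloc v hv _ hvy
      · exact (hlocU v hv z (hSU z hz)).2 e hze
    obtain ⟨hAN, hdAN⟩ := hloc v hv _ (hAv v hv)
    have hSY : ∀ t w, S ⊆ Y v t w := by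
      rintro t w s hs
      exact ⟨(hlocU v hv s (hSU s hs)).1, hs.2.1, Or.inl hs.1, fun h1 h2 => absurd ⟨h1, h2⟩ hs.2.2⟩
    have hvY : ∀ t w, v ∈ Y v t w := fun t w =>
      ⟨hvN v hv, hvU v hv, (hdv v hv).imp_right Or.inl, fun _ _ => Or.inl rfl⟩
    have hstart : ∀ t w, e ∈ Y v t w → ReachIn G (Y v t w) (dm (A v)) e := by
      intro t w he
      have h1 : A v ∈ Y v t w := ⟨hAN, hAU' v hv v hv rfl, Or.inr (Or.inl rfl), fun h1 h2 =>
        absurd rfl (hAJ v hv _ h1 h2.symm)⟩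
      have h2 : dm (A v) ∈ Y v t w := ⟨hdAN, hAU v hv, Or.inr (Or.inl (hdm.eq_self _ (hdm.mem _))),
        fun h1 _ => absurd (hdm.mem _) (hvD _ h1)⟩
      refine (hdm.reachIn h1 h2).symm.trans
        ((ReachIn.of_adj (hAv v hv).symm h1 (hvY t w)).trans ?_)
      rcases hlink with rfl | ⟨z, hyz, hyS, hzS, hze⟩
      · exact .of_adj hvy (hvY t w) he
      · exact (ReachIn.of_adj hvy (hvY t w) (hSY t w hyS)).trans
          ((hyz.mono (hSY t w)).trans (.of_adj hze (hSY t w hzS) he))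
    have hsep : ∀ t, ReachIn G (X v) e t → ¬ ReachIn G (X v) (dm (A v)) t := fun t het h =>
      hAy ((hA v hv v hv rfl).trans (h.trans (het.symm.trans hye.symm)))
    -- If `e` belongs to `J` with partner `U v`, the walk goes on through `A e` to `dm (A e)`, and
    -- `e` blocks it or not. Otherwise `U v` does not dominate `e`, and the walk ends at `dm e`.
    by_cases heJ : e ∈ J ∧ U e = U v
    · obtain ⟨heJ, heU'⟩ := heJ
      obtain ⟨hAeN, hdAeN⟩ := hloc e heJ _ (hAv e heJ)
      have hAeX : A e ∈ X v :=
        hX v hv _ hAeN (hAU' e heJ v hv heU') (hAJ e heJ v hv heU')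
      have hns := hsep _ ((ReachIn.of_adj (hAv e heJ) heX hAeX).trans (hA v hv e heJ heU'))
      have hAe : dm (A e) ≠ U v := heU' ▸ hAU e heJ
      have heY : e ∈ Y v (dm (A e)) e := ⟨heN.1, heU,
        (hdv e heJ).imp (fun h => h.trans heU') Or.inr, fun _ _ => Or.inr rfl⟩
      have hAeY : A e ∈ Y v (dm (A e)) e := ⟨hAeN, hAU' e heJ v hv heU', Or.inr (Or.inr rfl),
        fun h1 h2 => absurd rfl (hAJ e heJ _ h1 (heU'.trans h2.symm))⟩
      have hdAeY : dm (A e) ∈ Y v (dm (A e)) e := ⟨hdAeN, hAe,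
        Or.inr (Or.inr (hdm.eq_self _ (hdm.mem _))), fun h1 _ => absurd (hdm.mem _) (hvD _ h1)⟩
      have hr : ReachIn G (Y v (dm (A e)) e) (dm (A v)) (dm (A e)) :=
        (hstart _ _ heY).trans ((ReachIn.of_adj (hAv e heJ) heY hAeY).trans
          (hdm.reachIn hAeY hdAeY))
      by_cases hback : ReachIn G (X e) (dm (A v)) (dm (A e))
      · refine Or.inl ⟨(dm (A e), e), ⟨hdm.mem _, hdAeN, hAe, hns, hr⟩, ?_⟩
        rintro w - - ⟨rfl, -, h⟩
        exact h hback
      · exact Or.inr ⟨e, heJ, hev.symm, heU'.symm, hr, hns, hback⟩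
    · have hde : dm e ≠ U v := fun h => heS ⟨h, heU, heJ⟩
      have hdeX : dm e ∈ X v := hX v hv _ heN.2 hde (hne v hv _ (hdm.mem e))
      have heY : e ∈ Y v (dm e) v := ⟨heN.1, heU, Or.inr (Or.inr rfl), fun h1 h2 =>
        absurd ⟨h1, h2⟩ heJ⟩
      have hdeY : dm e ∈ Y v (dm e) v := ⟨heN.2, hde,
        Or.inr (Or.inr (hdm.eq_self _ (hdm.mem _))), fun h1 _ => absurd (hdm.mem _) (hvD _ h1)⟩
      -- The second entry `v` is a default: the walk meets no further vertex of `J` with this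
      -- partner, so no other vertex blocks it.
      refine Or.inl ⟨(dm e, v), ⟨hdm.mem e, heN.2, hde, hsep _ (hdm.reachIn heX hdeX),
        (hstart _ _ heY).trans (hdm.reachIn heY hdeY)⟩, ?_⟩
      rintro w - hwv ⟨h, -⟩
      exact hwv h.symm
  · rintro v hv w hw ⟨h1, h2, h3, h4, -⟩
    refine ⟨(dm (A w), w), ⟨hdm.mem _, (hloc w hw _ (hAv w hw)).2, ?_, h4, h3⟩, ?_⟩
    · change dm (A w) ≠ U v
      rw [h2]; exact hAU w hw
    · rintro w' - - hne' ⟨h, -⟩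
      exact hne' h.symm
  · intro I hIJ F hF hblk
    -- No hub is an end of its own edge, so `leaf` and `att` are arbitrary.
    let M : HubGraph V V :=
      { src := fun v => dm (A v)
        tgt := fun v => (F v).1
        hub := U
        leaf := U
        att := fun v _ => v }
    have hend : ∀ v ∈ I, ¬ M.Inc v (M.hub v) := by
      rintro v hv (h | h)
      · exact hAU v (hIJ hv) h
      · exact (hF v hv).2.2.1 h
    refine HubGraph.Hubbed.card_le (M := M) (E := I) ⟨?_, ?_, ?_⟩ ?_
    · intro v hv h
      exact (hF v hv).2.2.2.1 ((show dm (A v) = (F v).1 from h) ▸ .refl ..)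
    · exact fun v hv h => absurd h (hend v hv)
    · intro v hv hr
      refine (hF v hv).2.2.2.1 ?_
      change ReachIn G (X v) (M.src v) (M.tgt v)
      have hvJ := hIJ hv
      refine Relation.ReflTransGen.trans_induction_on
        (motive := fun {a b} _ => ReachIn G (X v) a b) hr (fun a => .refl ..) ?_
        (fun _ _ h1 h2 => h1.trans h2)
      rintro a b ⟨v', hv', hvv, hob, hj⟩
      obtain ⟨h1, h2, h3, h4, h5⟩ := hF v' hv'
      have hinc : ¬ M.Inc v' (U v) := fun h => hob ⟨h, fun h' => absurd h' (hend v hv)⟩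
      have key : ReachIn G (X v) (dm (A v')) (F v').1 := by
        -- With a common partner the walk can meet `v` only as its second entry, where not blocking
        -- helps. With different partners nothing on it is dominated by `U v`, and `hW` applies.
        by_cases hU : U v = U v'
        · by_cases hFv : (F v').2 = v
          · by_contra hcon
            exact hblk v' hv' v hv hvv.symm ⟨hFv, hU, hcon⟩
          · refine h5.mono fun z hz => hX v hvJ z hz.1 (hU ▸ hz.2.1) ?_
            rintro rfl
            rcases hz.2.2.2 hvJ hU with h | h
            · exact hvv h.symm
            · exact hFv h.symm
        · refine hW v hvJ _ _ (hne v hvJ _ (hdm.mem _)) (hne v hvJ _ h1)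
            (h5.mono fun z hz => ⟨hz.1, ?_⟩)
          rcases hz.2.2.1 with h | h | h <;> rw [h]
          · exact fun h' => hU h'.symm
          · exact fun h' => hinc (Or.inl h')
          · exact fun h' => hinc (Or.inr h')
      rcases hj with ⟨rfl, rfl⟩ | ⟨rfl, rfl⟩
      · exact key
      · exact key.symm
    · intro v hv x hx
      rcases hx with rfl | rfl
      · exact hDN _ (hdm.mem _) (hloc v (hIJ hv) _ (hAv v (hIJ hv))).2
      · exact hDN _ (hF v hv).1 (hF v hv).2.1

/-! ### Summing over the components of a cover -/

/-- The `r`-component of `x` in `S`. -/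
def rComponent (G : SimpleGraph V) (r : ℕ) (S : Set V) (x : V) : Set V :=
  {y | Relation.ReflTransGen (fun a b => a ∈ S ∧ b ∈ S ∧ G.edist a b ≤ (r : ℕ∞)) x y}

section rComponent

variable {r : ℕ} {S : Set V} {x y : V}

theorem mem_rComponent_self : x ∈ rComponent G r S x := Relation.ReflTransGen.refl

theorem rComponent_subset (hx : x ∈ S) : rComponent G r S x ⊆ S := by
  rintro y hy
  rcases Relation.ReflTransGen.cases_tail hy with rfl | ⟨z, -, hz⟩
  · exact hx
  · exact hz.2.1

theorem mem_rComponent_symm (h : y ∈ rComponent G r S x) : x ∈ rComponent G r S y := by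
  refine Relation.ReflTransGen.trans_induction_on
    (motive := fun {a b} _ => a ∈ rComponent G r S b) h (fun a => mem_rComponent_self) ?_
    fun _ _ h1 h2 => Relation.ReflTransGen.trans h2 h1
  rintro a b ⟨h1, h2, h3⟩
  exact Relation.ReflTransGen.single ⟨h2, h1, by rwa [SimpleGraph.edist_comm]⟩

theorem rComponent_eq (h : y ∈ rComponent G r S x) : rComponent G r S y = rComponent G r S x :=
  Set.Subset.antisymm (fun _ hz => Relation.ReflTransGen.trans h hz)
    fun _ hz => Relation.ReflTransGen.trans (mem_rComponent_symm h) hz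

theorem isRComponent_rComponent (hx : x ∈ S) : IsRComponent G r S (rComponent G r S x) := by
  refine ⟨⟨rComponent_subset hx, fun a ha b hb => ?_⟩, fun T hT hle z hz => ?_⟩
  · have hab : b ∈ rComponent G r S a := by rw [rComponent_eq ha]; exact hb
    rw [← rComponent_eq ha]
    clear hb
    induction hab with
    | refl => exact .refl
    | tail h1 h2 ih => exact ih.tail ⟨h1, Relation.ReflTransGen.tail h1 h2, h2.2.2⟩
  · exact Relation.ReflTransGen.mono
      (fun a b h => ⟨hT.1 h.1, hT.1 h.2.1, h.2.2⟩) _ _ (hT.2 x (hle mem_rComponent_self) z hz)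

/-- A common vertex of the two 4-neighbourhoods puts members of the components at distance at most
`4 + 4 ≤ r`. -/
theorem rComponent_eq_of_nbhd (hr : 8 ≤ r) {x' z : V} (hx : x ∈ S) (hx' : x' ∈ S)
    (hz : z ∈ nbhd G 4 (rComponent G r S x)) (hz' : z ∈ nbhd G 4 (rComponent G r S x')) :
    rComponent G r S x = rComponent G r S x' := by
  obtain ⟨t, ht, htz⟩ := hz
  obtain ⟨t', ht', htz'⟩ := hz'
  have htt : G.edist t t' ≤ (r : ℕ∞) := by
    refine (SimpleGraph.edist_triangle (v := z)).trans ?_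
    rw [SimpleGraph.edist_comm (u := z)]
    refine (add_le_add htz htz').trans ?_
    exact_mod_cast hr
  have h : t' ∈ rComponent G r S t :=
    Relation.ReflTransGen.single ⟨rComponent_subset hx ht, rComponent_subset hx' ht', htt⟩
  rw [← rComponent_eq ht, ← rComponent_eq h, rComponent_eq ht']

end rComponent

/-- Bounds relative to the components of the sets of a cover add up. -/
theorem card_le_of_cover {d c k r : ℕ} (hr : 8 ≤ r) {B : Fin (d + 1) → Set V}
    (hB : (⋃ i, B i) = Set.univ)
    (hbd : ∀ i, ∀ T : Set V, IsRComponent G r (B i) T → IsBoundedBy G k T)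
    (K D : Finset V) (key : V → V)
    (h : ∀ T : Set V, IsBoundedBy G k T → ∀ J ⊆ K, (∀ v ∈ J, key v ∈ T) →
      ∀ DN : Finset V, (∀ x ∈ D, x ∈ nbhd G 4 T → x ∈ DN) → J.card ≤ c * DN.card) :
    K.card ≤ (d + 1) * (c * D.card) := by
  classical
  have hidx : ∀ x : V, ∃ i, x ∈ B i := fun x => Set.mem_iUnion.1 (hB ▸ Set.mem_univ x)
  choose idx hidx using hidx
  have hclass : ∀ i, (K.filter fun v => idx (key v) = i).card ≤ c * D.card := by
    intro i
    set K' := K.filter fun v => idx (key v) = i with hK'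
    let comp : V → Set V := fun v => rComponent G r (B i) (key v)
    have hmem : ∀ v ∈ K', key v ∈ B i := by
      intro v hv
      rw [← (Finset.mem_filter.1 hv).2]
      exact hidx _
    let DN : Set V → Finset V := fun T => D.filter fun x => x ∈ nbhd G 4 T
    calc K'.card = ∑ T ∈ K'.image comp, (K'.filter fun v => comp v = T).card :=
          Finset.card_eq_sum_card_fiberwise fun v hv => Finset.mem_image_of_mem comp hv
      _ ≤ ∑ T ∈ K'.image comp, c * (DN T).card := by
          refine Finset.sum_le_sum fun T hT => ?_
          obtain ⟨v, hv, rfl⟩ := Finset.mem_image.1 hT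
          refine h (comp v) (hbd i _ (isRComponent_rComponent (hmem v hv))) _
            ((Finset.filter_subset _ _).trans (Finset.filter_subset _ _)) ?_ _
            fun x hx hxN => Finset.mem_filter.2 ⟨hx, hxN⟩
          intro w hw
          rw [← (Finset.mem_filter.1 hw).2]
          exact mem_rComponent_self
      _ = c * ((K'.image comp).biUnion DN).card := by
          rw [← Finset.mul_sum, Finset.card_biUnion]
          intro T hT T' hT' hne
          obtain ⟨v, hv, rfl⟩ := Finset.mem_image.1 hT
          obtain ⟨v', hv', rfl⟩ := Finset.mem_image.1 hT'
          refine Finset.disjoint_left.2 fun x hx hx' => hne ?_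
          exact rComponent_eq_of_nbhd hr (hmem v hv) (hmem v' hv') (Finset.mem_filter.1 hx).2
            (Finset.mem_filter.1 hx').2
      _ ≤ c * D.card := Nat.mul_le_mul_left c (Finset.card_le_card
          (Finset.biUnion_subset.2 fun T _ => Finset.filter_subset _ _))
  calc K.card = ∑ i, (K.filter fun v => idx (key v) = i).card :=
        Finset.card_eq_sum_card_fiberwise fun v _ => Finset.mem_univ _
    _ ≤ ∑ _i : Fin (d + 1), c * D.card := Finset.sum_le_sum fun i _ => hclass i
    _ = (d + 1) * (c * D.card) := by simp

/-! ### From local cuts to neighbourhoods of a component -/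

theorem edist_le_succ {t x y : V} {n : ℕ} (h : G.edist t x ≤ (n : ℕ∞)) (hxy : G.Adj x y) :
    G.edist t y ≤ ((n + 1 : ℕ) : ℕ∞) := by
  refine (SimpleGraph.edist_triangle (v := x)).trans ?_
  rw [Nat.cast_add, Nat.cast_one, SimpleGraph.edist_eq_one_iff_adj.2 hxy]
  exact add_le_add_left h 1

theorem mem_nbhd_of_le {T : Set V} {t x : V} {n r : ℕ} (ht : t ∈ T)
    (h : G.edist t x ≤ (n : ℕ∞)) (hn : n ≤ r) : x ∈ nbhd G r T :=
  ⟨t, ht, h.trans (by exact_mod_cast hn)⟩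

theorem IsDominator.edist_le_succ {D : Finset V} {dm : V → V} (hdm : IsDominator G D dm)
    {t x : V} {n : ℕ} (h : G.edist t x ≤ (n : ℕ∞)) : G.edist t (dm x) ≤ ((n + 1 : ℕ) : ℕ∞) := by
  by_cases hx : x ∈ D
  · rw [hdm.eq_self x hx]
    exact h.trans (by exact_mod_cast Nat.le_succ n)
  · exact DomCuts.edist_le_succ h (hdm.adj x hx)

theorem IsDominator.ne_of_not_adj {D : Finset V} {dm : V → V} (hdm : IsDominator G D dm) {u x : V}
    (hxu : x ≠ u) (h : ¬ G.Adj u x) : dm x ≠ u := by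
  rintro rfl
  by_cases hx : x ∈ D
  · exact hxu (hdm.eq_self x hx).symm
  · exact h (hdm.adj x hx).symm

theorem IsDominator.adj_of_eq {D : Finset V} {dm : V → V} (hdm : IsDominator G D dm) {u x : V}
    (hxu : x ≠ u) (h : dm x = u) : G.Adj x u := by
  by_contra hadj
  exact hdm.ne_of_not_adj hxu (fun h' => hadj h'.symm) h

/-- This is where `m ≥ k + 4` enters: walks in `N^4[T]` avoiding the cut lie in the region where it
separates. -/
theorem mem_cutRegion {T : Set V} {k m : ℕ} (hT : IsBoundedBy G k T) (hm : k + 4 ≤ m) {u v t z : V}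
    (ht : t ∈ T) (htuv : t ∈ ({u, v} : Set V)) (hz : z ∈ nbhd G 4 T) (hzu : z ≠ u) (hzv : z ≠ v) :
    z ∈ cutRegion G m u v := by
  obtain ⟨s, hs, hsz⟩ := hz
  refine ⟨⟨t, htuv, ?_⟩, by simp [hzu, hzv]⟩
  refine (SimpleGraph.edist_triangle (v := s)).trans ?_
  refine (add_le_add (hT t ht s hs) hsz).trans ?_
  exact_mod_cast hm

/-- A walk visiting `v` enters and leaves through neighbours not dominated by `u`; both are joined
to `a`, so the visit can be bypassed. -/
theorem reachIn_of_nbrs_joined {N X : Set V} {dm : V → V} {u v a : V}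
    (hX : ∀ z ∈ N, z ≠ u → z ≠ v → z ∈ X) (hu : dm u = u)
    (hnbr : ∀ w, G.Adj v w → w ≠ u → dm w ≠ u → ReachIn G X a w) {x y : V} (hx : x ≠ v)
    (hy : y ≠ v) (h : ReachIn G {z ∈ N | dm z ≠ u} x y) : ReachIn G X x y := by
  have hne : ∀ z, dm z ≠ u → z ≠ u := fun z hz h => hz (h ▸ hu)
  -- While the walk stands at `v`, the induction remembers the neighbour through which it entered.
  suffices hs : (y ≠ v → ReachIn G X x y) ∧
      (y = v → ∃ w, G.Adj v w ∧ w ≠ u ∧ dm w ≠ u ∧ ReachIn G X x w) from hs.1 hy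
  clear hy
  induction h with
  | refl => exact ⟨fun _ => .refl .., fun h => absurd h hx⟩
  | @tail b c _ hbc ih =>
    obtain ⟨hadj, ⟨hbN, hbu⟩, ⟨hcN, hcu⟩⟩ := hbc
    refine ⟨fun hc => ?_, ?_⟩
    · by_cases hb : b = v
      · obtain ⟨w, h1, h2, h3, h4⟩ := ih.2 hb
        exact h4.trans ((hnbr w h1 h2 h3).symm.trans (hnbr c (hb ▸ hadj) (hne c hcu) hcu))
      · exact (ih.1 hb).trans
          (.of_adj hadj (hX b hbN (hne b hbu) hb) (hX c hcN (hne c hcu) hc))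
    · rintro rfl
      exact ⟨b, hadj.symm, hne b hbu, hbu, ih.1 hadj.ne⟩

/-- The local conclusion of `card_le_of_dominating_partner`, for cuts given by `cutRegion`. -/
theorem card_le_of_bounded {m k : ℕ} (hm : k + 4 ≤ m) {T : Set V} (hT : IsBoundedBy G k T)
    {J D DN : Finset V} {dm U A : V → V} (hdm : IsDominator G D dm)
    (hDN : ∀ x ∈ D, x ∈ nbhd G 4 T → x ∈ DN) (hUT : ∀ v ∈ J, U v ∈ T)
    (hvD : ∀ v ∈ J, v ∉ D) (hUD : ∀ v ∈ J, U v ∈ D)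
    (hclose : ∀ v ∈ J, G.edist (U v) v ≤ ((2 : ℕ) : ℕ∞))
    (hAv : ∀ v ∈ J, G.Adj v (A v)) (hAU : ∀ v ∈ J, dm (A v) ≠ U v)
    (hdv : ∀ v ∈ J, dm v = U v ∨ dm v = dm (A v))
    (hAJ : ∀ v ∈ J, ∀ v' ∈ J, U v = U v' → A v ≠ v')
    (hjoin : ∀ v ∈ J, dm v = U v ∨
      ∀ w, G.Adj v w → w ≠ U v → dm w ≠ U v → ReachIn G (cutRegion G m (U v) v) (A v) w)
    (hy : ∀ v ∈ J, ∃ y x, G.Adj v y ∧ y ≠ U v ∧ ¬ ReachIn G (cutRegion G m (U v) v) (A v) y ∧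
      ReachIn G (cutRegion G m (U v) v) y x ∧ dm x ≠ U v) :
    J.card ≤ 2 * (3 * DN.card) := by
  have hX : ∀ v ∈ J, ∀ z ∈ nbhd G 4 T, z ≠ U v → z ≠ v → z ∈ cutRegion G m (U v) v :=
    fun v hv z hz h1 h2 => mem_cutRegion hT hm (hUT v hv) (by simp) hz h1 h2
  refine card_le_of_dominating_partner (N := nbhd G 4 T) (A := A) hdm hDN hX
    (fun v _ h => h.2 (by simp)) (fun v _ h => h.2 (by simp)) hvD hUD hAv hAU hdv hAJ ?_ ?_ ?_ ?_ hy
  · intro v hv x y hx hy hxy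
    have hUU : dm (U v) = U v := hdm.eq_self _ (hUD v hv)
    rcases hjoin v hv with h | h
    · refine hxy.mono fun z hz => hX v hv z hz.1 ?_ ?_
      · rintro rfl; exact hz.2 hUU
      · rintro rfl; exact hz.2 h
    · exact reachIn_of_nbrs_joined (hX v hv) hUU h hx hy hxy
  · exact fun v hv => mem_nbhd_of_le (hUT v hv) (hclose v hv) (by norm_num)
  · intro v hv w hw
    have h1 := edist_le_succ (hclose v hv) hw
    exact ⟨mem_nbhd_of_le (hUT v hv) h1 (by norm_num),
      mem_nbhd_of_le (hUT v hv) (hdm.edist_le_succ h1) (by norm_num)⟩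
  · intro v hv z hz
    have h0 : G.edist (U v) (U v) ≤ ((0 : ℕ) : ℕ∞) := by simp
    have h1 := edist_le_succ h0 hz.symm
    refine ⟨mem_nbhd_of_le (hUT v hv) h1 (by norm_num), fun w hw => ?_⟩
    have h2 := edist_le_succ h1 hw
    exact ⟨mem_nbhd_of_le (hUT v hv) h2 (by norm_num),
      mem_nbhd_of_le (hUT v hv) (hdm.edist_le_succ h2) (by norm_num)⟩

/-! ### The three kinds of interesting vertices -/

theorem exists_isDominator [Finite V] (G : SimpleGraph V) :
    ∃ (D : Finset V) (dm : V → V), D.card = MDS G ∧ IsDominator G D dm := by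
  classical
  have hne : {n | ∃ D : Set V, IsDominating G D ∧ D.ncard = n}.Nonempty :=
    ⟨_, Set.univ, fun v => Or.inl (Set.mem_univ v), rfl⟩
  obtain ⟨D, hD, hcard⟩ := Nat.sInf_mem hne
  have hfin := D.toFinite
  have hex : ∀ x, ∃ y, y ∈ D ∧ (x ∈ D → y = x) ∧ (x ∉ D → G.Adj x y) := by
    intro x
    by_cases hx : x ∈ D
    · exact ⟨x, hx, fun _ => rfl, fun h => absurd hx h⟩
    · obtain ⟨y, hy, hadj⟩ := (hD x).resolve_left hx
      exact ⟨y, hy, fun h => absurd h hx, fun _ => hadj.symm⟩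
  choose dm h1 h2 h3 using hex
  refine ⟨hfin.toFinset, dm, ?_, fun x => by simpa using h1 x, fun x hx => h2 x (by simpa using hx),
    fun x hx => h3 x (by simpa using hx)⟩
  rw [← Set.ncard_eq_toFinset_card D hfin, hcard]
  rfl

theorem ncard_isInteresting_le [Finite V] {d k m : ℕ} (hm : k + 4 ≤ m) {B : Fin (d + 1) → Set V}
    (hB : (⋃ i, B i) = Set.univ)
    (hbd : ∀ i, ∀ T : Set V, IsRComponent G 11 (B i) T → IsBoundedBy G k T) :
    {v : V | IsInteresting G m v}.ncard ≤ 19 * (d + 1) * MDS G := by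
  classical
  obtain ⟨D, dm, hDcard, hdm⟩ := exists_isDominator G
  have hcut : ∀ v, ∃ u, IsInteresting G m v → IsCutPartner G m v u := fun v => by
    by_cases h : IsInteresting G m v
    · exact h.exists_isCutPartner.imp fun u hu _ => hu
    · exact ⟨v, fun h' => absurd h' h⟩
  choose U hU using hcut
  have hfin : {v : V | IsInteresting G m v}.Finite := Set.toFinite _
  set Int := hfin.toFinset with hInt
  have hmemInt : ∀ v, v ∈ Int ↔ IsInteresting G m v := fun v => by simp [hInt]
  let X : V → Set V := fun v => cutRegion G m (U v) v
  let P : V → Prop := fun v =>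
    ∃ w, G.Adj v w ∧ w ≠ U v ∧ dm w ≠ U v ∧ ¬ ReachIn G (X v) (dm v) w
  let K₁ := Int.filter fun v => v ∉ D ∧ dm v ≠ U v ∧ P v
  let K₂ := Int.filter fun v => v ∉ D ∧ dm v ≠ U v ∧ ¬ P v
  let K₃ := Int.filter fun v => v ∉ D ∧ dm v = U v
  -- a vertex on the far side of the cut, and a neighbour of `v` there
  have hfar : ∀ v ∈ Int, ∀ a, ∃ y x, G.Adj v y ∧ y ≠ U v ∧ ¬ ReachIn G (X v) a y ∧
      ReachIn G (X v) y x ∧ dm x ≠ U v := by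
    intro v hv a
    obtain ⟨-, -, ⟨x₁, hx₁, x₂, hx₂, ha₁, ha₂, hr⟩, hnbr⟩ := hU v ((hmemInt v).1 hv)
    obtain ⟨x, hx, hax, hr⟩ : ∃ x ∈ X v, ¬ G.Adj (U v) x ∧ ¬ ReachIn G (X v) a x := by
      by_cases h : ReachIn G (X v) a x₁
      · exact ⟨x₂, hx₂, ha₂, fun h' => hr (h.symm.trans h')⟩
      · exact ⟨x₁, hx₁, ha₁, h⟩
    obtain ⟨y, h1, h2, h3⟩ := hnbr x hx
    exact ⟨y, x, h1, h2, fun h => hr (h.trans h3.symm), h3.symm,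
      hdm.ne_of_not_adj (fun h => hx.2 (by simp [h])) hax⟩
  have hK₁ : K₁.card ≤ (d + 1) * (6 * D.card) := by
    -- Here `U v` may be far from `v`, but the walks stay within distance 2 of `v`, so `v` itself
    -- selects the component. For the other kinds the walks run around `U v`.
    refine card_le_of_cover (by norm_num) hB hbd K₁ D id fun T hT J hJ hJT DN hDN => ?_
    have hJ' : ∀ v ∈ J, IsInteresting G m v ∧ v ∉ D ∧ dm v ≠ U v ∧ P v := fun v hv =>
      (Finset.mem_filter.1 (hJ hv)).imp_left (hmemInt v).1
    have := card_le_of_separated_nbr (J := J) (N := nbhd G 4 T) (X := X) (U := U) hdm hDN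
      (fun v hv z hz h1 h2 => mem_cutRegion hT hm (hJT v hv) (by simp) hz h1 h2)
      (fun v hv => (hJ' v hv).2.1) (fun v hv => (hU v (hJ' v hv).1).1.symm)
      (fun v hv => (hJ' v hv).2.2.1) ?_ (fun v hv => (hJ' v hv).2.2.2)
    · omega
    · intro v hv
      have h0 : G.edist v v ≤ ((0 : ℕ) : ℕ∞) := by simp
      refine ⟨mem_nbhd_of_le (hJT v hv) h0 (by norm_num),
        mem_nbhd_of_le (hJT v hv) (hdm.edist_le_succ h0) (by norm_num), fun w hw => ?_⟩
      have h1 := edist_le_succ h0 hw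
      exact ⟨mem_nbhd_of_le (hJT v hv) h1 (by norm_num),
        mem_nbhd_of_le (hJT v hv) (hdm.edist_le_succ h1) (by norm_num)⟩
  have hK₂ : K₂.card ≤ (d + 1) * (6 * D.card) := by
    refine card_le_of_cover (by norm_num) hB hbd K₂ D U fun T hT J hJ hJT DN hDN => ?_
    have hJ' : ∀ v ∈ J, v ∈ Int ∧ v ∉ D ∧ dm v ≠ U v ∧ ¬ P v := fun v hv =>
      Finset.mem_filter.1 (hJ hv)
    have hnbr : ∀ v ∈ J, ∀ w, G.Adj v w → w ≠ U v → dm w ≠ U v → ReachIn G (X v) (dm v) w := by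
      intro v hv w h1 h2 h3
      by_contra h4
      exact (hJ' v hv).2.2.2 ⟨w, h1, h2, h3, h4⟩
    -- Neighbours not dominated by `U v` are on the side of `dm v`, so one on the far side is
    -- dominated by `U v`. Hence `U v ∈ D`, at distance at most 2 from `v`.
    have hmid : ∀ v ∈ J, ∃ y, G.Adj v y ∧ y ≠ U v ∧ dm y = U v := by
      intro v hv
      obtain ⟨y, x, h1, h2, h3, -⟩ := hfar v (hJ' v hv).1 (dm v)
      refine ⟨y, h1, h2, ?_⟩
      by_contra h4
      exact h3 (hnbr v hv y h1 h2 h4)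
    have := card_le_of_bounded (J := J) (U := U) (A := dm) hm hT hdm hDN hJT
      (fun v hv => (hJ' v hv).2.1) (fun v hv => ?_) (fun v hv => ?_)
      (fun v hv => hdm.adj v (hJ' v hv).2.1)
      (fun v hv => by rw [hdm.eq_self _ (hdm.mem v)]; exact (hJ' v hv).2.2.1)
      (fun v _ => Or.inr (hdm.eq_self _ (hdm.mem v)).symm)
      (fun v _ v' hv' _ h => (hJ' v' hv').2.1 (h ▸ hdm.mem v))
      (fun v hv => Or.inr (hnbr v hv)) (fun v hv => hfar v (hJ' v hv).1 (dm v))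
    · omega
    · obtain ⟨y, -, -, h⟩ := hmid v hv
      exact h ▸ hdm.mem y
    · obtain ⟨y, h1, h2, h3⟩ := hmid v hv
      have h0 : G.edist (U v) (U v) ≤ ((0 : ℕ) : ℕ∞) := by simp
      exact edist_le_succ (edist_le_succ h0 (hdm.adj_of_eq h2 h3).symm) h1.symm
  have hK₃ : K₃.card ≤ (d + 1) * (6 * D.card) := by
    refine card_le_of_cover (by norm_num) hB hbd K₃ D U fun T hT J hJ hJT DN hDN => ?_
    have hJ' : ∀ v ∈ J, v ∈ Int ∧ v ∉ D ∧ dm v = U v := fun v hv => Finset.mem_filter.1 (hJ hv)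
    have hadj : ∀ v ∈ J, G.Adj v (U v) := fun v hv => by
      rw [← (hJ' v hv).2.2]; exact hdm.adj v (hJ' v hv).2.1
    -- The condition `N[v] ⊈ N[U v]` is needed here: its witness is not `v`, which is adjacent to `U
    -- v`.
    have hA : ∀ v ∈ J, ∃ a, G.Adj v a ∧ dm a ≠ U v := by
      intro v hv
      obtain ⟨-, ⟨w, hw, hwu⟩, -⟩ := hU v ((hmemInt v).1 (hJ' v hv).1)
      have hwu' : w ≠ U v ∧ ¬ G.Adj (U v) w := by
        simpa [closedNbhd, not_or] using hwu
      rcases hw with rfl | hw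
      · exact absurd (hadj _ hv).symm hwu'.2
      · exact ⟨w, hw, hdm.ne_of_not_adj hwu'.1 hwu'.2⟩
    choose! A hA hAU using hA
    have := card_le_of_bounded (J := J) (U := U) (A := A) hm hT hdm hDN hJT
      (fun v hv => (hJ' v hv).2.1) (fun v hv => (hJ' v hv).2.2 ▸ hdm.mem v) (fun v hv => ?_)
      hA hAU (fun v hv => Or.inl (hJ' v hv).2.2) (fun v hv v' hv' hUU h => ?_)
      (fun v hv => Or.inl (hJ' v hv).2.2) (fun v hv => hfar v (hJ' v hv).1 (A v))
    · omega
    · exact (SimpleGraph.edist_eq_one_iff_adj.2 (hadj v hv).symm).le.trans (by norm_num)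
    · exact hAU v hv (by rw [h, hUU]; exact (hJ' v' hv').2.2)
  have hcover : Int ⊆ D ∪ (K₁ ∪ (K₂ ∪ K₃)) := by
    intro v hv
    by_cases h1 : v ∈ D <;> by_cases h2 : dm v = U v <;> by_cases h3 : P v <;>
      simp [K₁, K₂, K₃, hv, h1, h2, h3]
  have h1 := (Finset.card_le_card hcover).trans ((Finset.card_union_le _ _).trans
    (Nat.add_le_add_left ((Finset.card_union_le _ _).trans
      (Nat.add_le_add_left (Finset.card_union_le _ _) _)) _))
  rw [Set.ncard_eq_toFinset_card _ hfin, ← hDcard]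
  nlinarith [Nat.zero_le (d * D.card)]

end DomCuts

theorem mainTheorem5 (C : DomCuts.GraphClass.{u}) (d : ℕ) (f : ℕ → ℕ)
    (hf : DomCuts.IsControlFunction C d f)
    (m : ℕ) (hm : m = f 11 + 4 ∨ m = f 11 + 5)
    (V : Type u) [Finite V] (G : SimpleGraph V) (hG : C V G) :
    {v : V | DomCuts.IsInteresting G m v}.ncard ≤ 22 * (d + 1) * DomCuts.MDS G := by
  obtain ⟨B, hB, hbd⟩ := hf V G hG 11 (by norm_num)
  refine (DomCuts.ncard_isInteresting_le (by omega) hB hbd).trans ?_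
  gcongr
  norm_num
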